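/- **Theorem (qNBO (BFGS) with warm-up, quadratic lower level).** Let $A\in\mathbb R^{n\times n}$ be symmetric with $\mu I\preceq A\preceq LI$, $\mu>0$, and consider $$\min_{x\in\mathbb R^n}\Phi(x):=F(x,y^*(x)),\qquad y^*(x)=\arg\min_{y\in\mathbb R^n} f(x,y),\qquad f(x,y)=\tfrac12y^TAy-y^Tx .$$ *Assumptions on $F$.* $F$ is differentiable; $\nabla_xF$ is $L_{F_x}$-Lipschitz in $y$ for each fixed $x$ and in $x$ for each fixed $y$; $\nabla_yF$ is $L_{F_y}$-Lipschitz in $y$ and $\bar L_{F_y}$-Lipschitz in $x$; $\|\nabla_yF(x,y)\|\le C_{F_y}$ for all $x,y$; and $\Phi$ is bounded below, $\Phi^*:=\inf_x\Phi(x)$. *Assumptions on $f$* (which define the remaining constants). $f$ is $C^2$; $f(x,\cdot)$ is $\mu$-strongly convex; $\nabla_yf$ and $\nabla^2_{yy}f$ are Lipschitz in $y$ with constants $L$ and $L_{f_{yy}}$; $\nabla^2_{xy}f$ is $L_{f_{xy}}$-Lipschitz in $y$ and $\|\nabla^2_{xy}f\|\le M_{f_{xy}}$; $\nabla^2_{xy}f$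 and $\nabla^2_{yy}f$ are Lipschitz in $x$ with constants $\bar L_{f_{xy}}$ and $\bar L_{f_{yy}}$. *Algorithm.* The BFGS update of a matrix $H$ by a pair $(s,g)$ is $(I-\rho sg^T)H(I-\rho gs^T)+\rho ss^T$, $\rho=1/(g^Ts)$ ($H$ is left unchanged if $s=0$). Given $(x_0,y_0)$ and $H_0$, for $k=0,1,\dots$: 1. From $y_k$ perform $P$ gradient steps $y\leftarrow y-\beta\nabla_yf(x_k,y)$, and then, starting from the matrix $H_0$, $T\ge1$ unit-step BFGS steps $y_{k,t+1}=y_{k,t}-H_{k,t}\nabla_yf(x_k,y_{k,t})$, where $H_{k,t+1}$ is the BFGS update of $H_{k,t}$ by $s=y_{k,t+1}-y_{k,t}$, $g=\nabla_yf(x_k,y_{k,t+1})-\nabla_yf(x_k,y_{k,t})$. Set $y_{k+1}=y_{k,T}$. 2. Let $d=\nabla_yF(x_k,y_{k+1})$. If $Q_k=1$, set $u_{k+1}=H_{k,T}d$. If $Q_k>1$, restart from $\tilde H_0=H_0$, let $u_i=\tilde H_id$ and $\tilde s_i=\xi_{k,i}u_i$ (with $\xi_{k,i}>0$ arbitrary),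 let $\tilde H_{i+1}$ be the BFGS update of $\tilde H_i$ by $\tilde s_i$ and $\tilde g_i=\nabla_yf(x_k,y_{k+1}+\tilde s_i)-\nabla_yf(x_k,y_{k+1})$, and set $u_{k+1}=u_{Q_k-1}$. 3. $x_{k+1}=x_k-\alpha\big(\nabla_xF(x_k,y_{k+1})-[\nabla^2_{xy}f(x_k,y_{k+1})]^Tu_{k+1}\big)$. *Constants.* Put $\kappa=L/\mu$, $L_y=M_{f_{xy}}/\mu$, $D=L_{F_x}^2+\frac{L_{f_{xy}}^2C_{F_y}^2}{\mu^2}+\frac{2M_{f_{xy}}^2L_{F_y}^2}{\mu^2}$, $$C=L_{F_x}+\tfrac{L_{F_y}M_{f_{xy}}}{\mu}+C_{F_y}\Big(\tfrac{L_{f_{xy}}}{\mu}+\tfrac{L_{f_{yy}}M_{f_{xy}}}{\mu^2}\Big),\qquad L_\Phi=\tfrac{(\bar L_{F_y}+C)M_{f_{xy}}}{\mu}+L_{F_x}+C_{F_y}\Big(\tfrac{\bar L_{f_{xy}}C_{F_y}}{\mu}+\tfrac{\bar L_{f_{yy}}M_{f_{xy}}}{\mu^2}\Big),$$ and, for $\varepsilon>0$,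 $$\tau=\kappa\big(\tfrac1T\big)^T(1-\beta\mu)^P\Big((1+\varepsilon)+6\big(1+\tfrac1\varepsilon\big)L_y^2\alpha^2D\Big),\qquad \omega=6D\big(1+\tfrac1\varepsilon\big)\kappa\big(\tfrac1T\big)^T(1-\beta\mu)^PL_y^2,$$ $$\delta_0=3\kappa\big(\tfrac1T\big)^T(1-\beta\mu)^PD\,\|y^*(x_0)-y_0\|^2 .$$ *Claim.* Let $K\ge1$, $Q_k\ge1$, $\alpha,\varepsilon>0$, $0<\beta\le\frac2{\mu+L}$, and suppose that for all $k<K$ $$(1-\beta\mu)^P\|y_k-y^*(x_k)\|\le\frac1{300\sqrt\mu},\qquad \big\|G_k^{-1/2}(H_0^{-1}-G_k)G_k^{-1/2}\big\|_F\le\frac17,\quad G_k=\nabla^2_{yy}f(x_k,y^*(x_k)),$$ and that $$\tau<1,\qquad \alpha L_\Phi+\omega\alpha^2\big(\tfrac12+\alpha L_\Phi\big)\frac1{1-\tau}\le\frac14 .$$ Then $\Phi$ is differentiable and $$\frac1K\sum_{k=0}^{K-1}\|\nabla\Phi(x_k)\|^2\le\frac{4(\Phi(x_0)-\Phi^*)}{\alpha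 K}+\frac{3\delta_0}{K(1-\tau)}+\frac1K\sum_{k=0}^{K-1}\frac{18nLM_{f_{xy}}^2C_{F_y}^2}{\mu^3Q_k}.$$ -/

import Mathlib

open scoped NNReal

noncomputable section

namespace QNBO

/-- The Euclidean space `ℝⁿ`. -/
abbrev E (n : ℕ) : Type := EuclideanSpace ℝ (Fin n)

/-! ### Partial derivatives of functions of two vector variables -/

/-- The partial gradient `∇_x G(x, y)`. -/
def gradX {m n : ℕ} (G : E m → E n → ℝ) (x : E m) (y : E n) : E m :=
  gradient (fun x' => G x' y) x

/-- The partial gradient `∇_y G(x, y)`. -/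
def gradY {m n : ℕ} (G : E m → E n → ℝ) (x : E m) (y : E n) : E n :=
  gradient (fun y' => G x y') y

/-- The partial Hessian `∇²_yy G(x, y)`, as an operator on `ℝⁿ`. -/
def hessYY {m n : ℕ} (G : E m → E n → ℝ) (x : E m) (y : E n) : E n →L[ℝ] E n :=
  fderiv ℝ (fun y' => gradY G x y') y

/-- The mixed second derivative `∇²_xy G(x, y)`, an `n × m` Jacobian: the derivative in `x` of
`∇_y G`. -/
def hessXY {m n : ℕ} (G : E m → E n → ℝ) (x : E m) (y : E n) : E m →L[ℝ] E n :=
  fderiv ℝ (fun x' => gradY G x' y) x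

/-! ### The bilevel problem -/

/-- The lower-level solution `y*(x)`, a minimizer of `f(x, ·)`
(unique when `f(x, ·)` is strongly convex). -/
def lowerSol {m n : ℕ} (f : E m → E n → ℝ) (x : E m) : E n :=
  Classical.epsilon fun y => ∀ z, f x y ≤ f x z

/-- The reduced objective `Φ(x) = F(x, y*(x))`. -/
def upperValue {m n : ℕ} (F f : E m → E n → ℝ) (x : E m) : ℝ :=
  F x (lowerSol f x)

/-- The quadratic lower-level objective `f(x, y) = ½ yᵀAy - yᵀx`. -/
def quadLower {n : ℕ} (A : Matrix (Fin n) (Fin n) ℝ) (x y : E n) : ℝ :=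
  (1 / 2) * inner ℝ y (Matrix.toEuclideanCLM (n := Fin n) (𝕜 := ℝ) A y) - inner ℝ y x

/-- The constants of the problem: `LFx, LFy, LbarFy, CFy` belong to the upper level objective,
the others to the lower level one. -/
structure Constants where
  (LFx LFy LbarFy CFy : ℝ≥0)
  (mu L Lfyy Lfxy Mfxy Lbarfxy Lbarfyy : ℝ≥0)

/-- The assumptions on the upper-level objective. -/
structure UpperAssumption {m n : ℕ} (F : E m → E n → ℝ) (c : Constants) : Prop where
  differentiable : Differentiable ℝ (Function.uncurry F)
  gradX_lipschitz_y : ∀ x, LipschitzWith c.LFx fun y => gradX F x y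
  gradX_lipschitz_x : ∀ y, LipschitzWith c.LFx fun x => gradX F x y
  gradY_lipschitz_y : ∀ x, LipschitzWith c.LFy fun y => gradY F x y
  gradY_lipschitz_x : ∀ y, LipschitzWith c.LbarFy fun x => gradY F x y
  gradY_bounded : ∀ x y, ‖gradY F x y‖ ≤ c.CFy

/-- The assumptions on the lower-level objective. -/
structure LowerAssumption {m n : ℕ} (f : E m → E n → ℝ) (c : Constants) : Prop where
  contDiff : ContDiff ℝ 2 (Function.uncurry f)
  mu_pos : 0 < c.mu
  strongConvex : ∀ x, StrongConvexOn Set.univ (c.mu : ℝ) fun y => f x y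
  gradY_lipschitz_y : ∀ x, LipschitzWith c.L fun y => gradY f x y
  hessYY_lipschitz_y : ∀ x, LipschitzWith c.Lfyy fun y => hessYY f x y
  hessXY_lipschitz_y : ∀ x, LipschitzWith c.Lfxy fun y => hessXY f x y
  hessXY_bounded : ∀ x y, ‖hessXY f x y‖ ≤ c.Mfxy
  hessXY_lipschitz_x : ∀ y, LipschitzWith c.Lbarfxy fun x => hessXY f x y
  hessYY_lipschitz_x : ∀ y, LipschitzWith c.Lbarfyy fun x => hessYY f x y

/-! ### The algorithm qNBO (BFGS) -/

/-- The BFGS update of the inverse Hessian approximation,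
`(I - ρ s gᵀ) H (I - ρ g sᵀ) + ρ s sᵀ` with `ρ = 1 / gᵀs`.  If `s = 0` (so `g = 0`; the inner
iteration has already converged) the convention `1 / 0 = 0` leaves `H` unchanged. -/
def bfgsUpdate {n : ℕ} (H : Matrix (Fin n) (Fin n) ℝ) (s g : E n) :
    Matrix (Fin n) (Fin n) ℝ :=
  let ρ : ℝ := 1 / inner ℝ g s
  (1 - ρ • Matrix.vecMulVec s.ofLp g.ofLp) * H * (1 - ρ • Matrix.vecMulVec g.ofLp s.ofLp)
    + ρ • Matrix.vecMulVec s.ofLp s.ofLp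

/-- The matrix-vector product `H d`. -/
def matVec {n : ℕ} (H : Matrix (Fin n) (Fin n) ℝ) (d : E n) : E n :=
  Matrix.toEuclideanCLM (n := Fin n) (𝕜 := ℝ) H d

/-- State of the quasi-Newton iteration: the point `y_t` and the matrix `H_t` that is determined
by `H₀` and the pairs `(s_i, g_i)`, `i < t`. -/
structure QNState (n : ℕ) where
  y : E n
  H : Matrix (Fin n) (Fin n) ℝ

/-- One quasi-Newton step `y_{t+1} = y_t - γ H_t ∇g(y_t)`, followed by the BFGS update with
`s_t = y_{t+1} - y_t` and `g_t = ∇g(y_{t+1}) - ∇g(y_t)`. -/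
def qnStep {n : ℕ} (grad : E n → E n) (γ : ℝ) (σ : QNState n) : QNState n :=
  let y' := σ.y - γ • matVec σ.H (grad σ.y)
  ⟨y', bfgsUpdate σ.H (y' - σ.y) (grad y' - grad σ.y)⟩

/-- `P` warm-up gradient steps `y ← y - β ∇g(y)`. -/
def warmUp {n : ℕ} (grad : E n → E n) (β : ℝ) (P : ℕ) (y : E n) : E n :=
  (fun z => z - β • grad z)^[P] y

/-- Subroutine `𝒜`: `P` gradient steps followed by `T` quasi-Newton steps started at `H₀`.
It returns `y_T` together with `H_T`. -/
def subroutineA {n : ℕ} (grad : E n → E n) (H₀ : Matrix (Fin n) (Fin n) ℝ)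
    (β γ : ℝ) (P T : ℕ) (y : E n) : QNState n :=
  (qnStep grad γ)^[T] ⟨warmUp grad β P y, H₀⟩

/-- The matrices of subroutine `ℬ`: `H_0 = H₀`, and `H_{i+1}` is the BFGS update of `H_i` with
`s̃_i = ξ_i u_i`, `g̃_i = ∇g(y + s̃_i) - ∇g(y)`, where `u_i = H_i d`. -/
def subroutineBMatrix {n : ℕ} (grad : E n → E n) (y : E n) (H₀ : Matrix (Fin n) (Fin n) ℝ)
    (d : E n) (ξ : ℕ → ℝ) : ℕ → Matrix (Fin n) (Fin n) ℝ
  | 0 => H₀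
  | i + 1 =>
    let H := subroutineBMatrix grad y H₀ d ξ i
    let s := ξ i • matVec H d
    bfgsUpdate H s (grad (y + s) - grad y)

/-- Subroutine `ℬ` returns `u_{Q-1} = H_{Q-1} d`. -/
def subroutineB {n : ℕ} (grad : E n → E n) (y : E n) (H₀ : Matrix (Fin n) (Fin n) ℝ)
    (d : E n) (ξ : ℕ → ℝ) (Q : ℕ) : E n :=
  matVec (subroutineBMatrix grad y H₀ d ξ (Q - 1)) d

/-- The parameters of the algorithm: outer stepsize `α`, warm-up stepsize `β`, quasi-Newton
stepsize `γ`, warm-up steps `P`, quasi-Newton steps `T`, the numbers `Q_k`, the stepsizes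
`ξ_{k,i}` of subroutine `ℬ` in outer iteration `k`, and the initial matrix `H₀`. -/
structure Params (n : ℕ) where
  (α β γ : ℝ)
  (P T : ℕ)
  Q : ℕ → ℕ
  ξ : ℕ → ℕ → ℝ
  H₀ : Matrix (Fin n) (Fin n) ℝ

/-- Outer iteration number `k`, from `(x_k, y_k)` to `(x_{k+1}, y_{k+1})`. -/
def outerStep {m n : ℕ} (F f : E m → E n → ℝ) (p : Params n) (k : ℕ) (z : E m × E n) :
    E m × E n :=
  let x := z.1
  let σ := subroutineA (gradY f x) p.H₀ p.β p.γ p.P p.T z.2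
  let d := gradY F x σ.y
  let u := if p.Q k = 1 then matVec σ.H d
    else subroutineB (gradY f x) σ.y p.H₀ d (p.ξ k) (p.Q k)
  (x - p.α • (gradX F x σ.y - (hessXY f x σ.y).adjoint u), σ.y)

/-- The iterates `(x_k, y_k)` of qNBO (BFGS) started at `(x₀, y₀)`. -/
def iterates {m n : ℕ} (F f : E m → E n → ℝ) (p : Params n) (x₀ : E m) (y₀ : E n) :
    ℕ → E m × E n
  | 0 => (x₀, y₀)
  | k + 1 => outerStep F f p k (iterates F f p x₀ y₀ k)

/-! ### The relative Frobenius distance -/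

section Frobenius
open scoped Matrix.Norms.Frobenius

/-- The Frobenius norm. -/
def frobNorm {n : ℕ} (M : Matrix (Fin n) (Fin n) ℝ) : ℝ := ‖M‖

end Frobenius

section Sqrt
open scoped MatrixOrder

/-- `‖G^{-1/2} (B - G) G^{-1/2}‖_F`, for a positive definite `G`. -/
def relFrobDist {n : ℕ} (B G : Matrix (Fin n) (Fin n) ℝ) : ℝ :=
  frobNorm ((CFC.sqrt G)⁻¹ * (B - G) * (CFC.sqrt G)⁻¹)

end Sqrt

/-- The matrix of `∇²_yy f(x, y)` in the standard basis. -/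
def hessYYMatrix {m n : ℕ} (f : E m → E n → ℝ) (x : E m) (y : E n) :
    Matrix (Fin n) (Fin n) ℝ :=
  (Matrix.toEuclideanCLM (n := Fin n) (𝕜 := ℝ)).symm (hessYY f x y)

/-! ### The constants of the convergence rate -/

namespace Constants

/-- The condition number `κ = L / μ`. -/
def kappa (c : Constants) : ℝ := c.L / c.mu

/-- The Lipschitz constant `L_y = M_{f_xy} / μ` of `y*`. -/
def Ly (c : Constants) : ℝ := c.Mfxy / c.mu

/-- `C = L_{F_x} + L_{F_y} M_{f_xy}/μ + C_{F_y} (L_{f_xy}/μ + L_{f_yy} M_{f_xy}/μ²)`. -/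
def C (c : Constants) : ℝ :=
  c.LFx + c.LFy * c.Mfxy / c.mu
    + c.CFy * (c.Lfxy / c.mu + c.Lfyy * c.Mfxy / (c.mu : ℝ) ^ 2)

/-- The Lipschitz constant `L_Φ` of `∇Φ`. -/
def LPhi (c : Constants) : ℝ :=
  (c.LbarFy + c.C) * c.Mfxy / c.mu + c.LFx
    + c.CFy * (c.Lbarfxy * c.CFy / c.mu + c.Lbarfyy * c.Mfxy / (c.mu : ℝ) ^ 2)

/-- `L_{F_x}² + L_{f_xy}² C_{F_y}² / μ² + 2 M_{f_xy}² L_{F_y}² / μ²`. -/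
def D (c : Constants) : ℝ :=
  (c.LFx : ℝ) ^ 2 + (c.Lfxy : ℝ) ^ 2 * (c.CFy : ℝ) ^ 2 / (c.mu : ℝ) ^ 2
    + 2 * (c.Mfxy : ℝ) ^ 2 * (c.LFy : ℝ) ^ 2 / (c.mu : ℝ) ^ 2

/-- The factor `κ (1/T)^T (1 - βμ)^P`. -/
def rate (c : Constants) (β : ℝ) (P T : ℕ) : ℝ :=
  c.kappa * (1 / (T : ℝ)) ^ T * (1 - β * c.mu) ^ P

/-- `τ = κ (1/T)^T (1 - βμ)^P ((1 + ε) + 6 (1 + 1/ε) L_y² α² D)`. -/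
def tau (c : Constants) (α β ε : ℝ) (P T : ℕ) : ℝ :=
  c.rate β P T * ((1 + ε) + 6 * (1 + 1 / ε) * c.Ly ^ 2 * α ^ 2 * c.D)

/-- `ω = 6 D (1 + 1/ε) κ (1/T)^T (1 - βμ)^P L_y²`. -/
def omega (c : Constants) (β ε : ℝ) (P T : ℕ) : ℝ :=
  6 * c.D * (1 + 1 / ε) * c.rate β P T * c.Ly ^ 2

end Constants

end QNBO

end

noncomputable section

namespace QNBO

open Matrix

variable {n : ℕ}

/-! ### Matrix-vector products -/

/-! For the quadratic lower level, `y*(x) = A⁻¹x`, the mixed derivative is `-I`, and the chain rule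
gives `∇Φ(x) = ∇_x F + A⁻¹ ∇_y F` at `(x, A⁻¹x)` (`hyperGrad`). The algorithm is therefore gradient
descent on `Φ` with two errors: `y_{k+1}` replaces `A⁻¹x_k`, and `u_{k+1}` replaces `A⁻¹d`.

Both errors are read off one matrix. Let `R = A^{1/2}` and `X = R H R - I`. Every BFGS pair
satisfies `g = A s` exactly, so an update replaces `X` by `(I - P) X (I - P)`, with `P` the
orthogonal projection onto `v = R s` (`relErr_bfgsUpdate`). Hence `‖X‖_F²` drops by at least `‖X v‖²
/ ‖v‖²` (`frobNorm_sq_compress_le`), and the initial bound `‖X‖_F ≤ 1/6` is never lost.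

A unit quasi-Newton step sends the scaled error `z = R (y - y*)` to `-X z`, so its squared
contraction factor is at most a constant times that drop. The drops sum to at most `1/36`, and AM-GM
on their product gives `(1/T)^T` (`bfgs_superlinear`). In subroutine `ℬ` each update annihilates the
current direction `R u`, so the error in the action on `d` shrinks by `1/6` per step
(`subroutineBMatrix_quadratic`).

It remains to couple the descent inequality for `Φ` with a contraction of `‖y_k - y*(x_k)‖²`, which
is perturbed by the motion of `x_k`, and to sum both over `k` (`sum_le_of_coupled_recursion`). -/

@[simp] lemma ofLp_matVec (M : Matrix (Fin n) (Fin n) ℝ) (v : E n) :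
    (matVec M v).ofLp = M *ᵥ v.ofLp := rfl

lemma matVec_mul (M N : Matrix (Fin n) (Fin n) ℝ) (v : E n) :
    matVec (M * N) v = matVec M (matVec N v) := by
  ext1; simp [Matrix.mulVec_mulVec]

@[simp] lemma matVec_one (v : E n) : matVec 1 v = v := by
  ext1; simp

lemma matVec_add (M N : Matrix (Fin n) (Fin n) ℝ) (v : E n) :
    matVec (M + N) v = matVec M v + matVec N v := by
  ext1; simp [Matrix.add_mulVec]

lemma matVec_sub (M N : Matrix (Fin n) (Fin n) ℝ) (v : E n) :
    matVec (M - N) v = matVec M v - matVec N v := by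
  ext1; simp [Matrix.sub_mulVec]

lemma matVec_smul (a : ℝ) (M : Matrix (Fin n) (Fin n) ℝ) (v : E n) :
    matVec (a • M) v = a • matVec M v := by
  ext1; simp [Matrix.smul_mulVec]

lemma matVec_map_add (M : Matrix (Fin n) (Fin n) ℝ) (v w : E n) :
    matVec M (v + w) = matVec M v + matVec M w := map_add _ v w

lemma matVec_map_sub (M : Matrix (Fin n) (Fin n) ℝ) (v w : E n) :
    matVec M (v - w) = matVec M v - matVec M w := map_sub _ v w

lemma matVec_map_neg (M : Matrix (Fin n) (Fin n) ℝ) (v : E n) :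
    matVec M (-v) = -matVec M v := map_neg _ v

lemma matVec_map_smul (M : Matrix (Fin n) (Fin n) ℝ) (a : ℝ) (v : E n) :
    matVec M (a • v) = a • matVec M v := map_smul _ a v

@[simp] lemma matVec_map_zero (M : Matrix (Fin n) (Fin n) ℝ) :
    matVec M (0 : E n) = 0 := map_zero _

lemma inner_eq_dotProduct (v w : E n) : inner ℝ v w = v.ofLp ⬝ᵥ w.ofLp := by
  simpa using Matrix.inner_toEuclideanCLM (1 : Matrix (Fin n) (Fin n) ℝ) v w

lemma norm_sq_eq_dotProduct (v : E n) : ‖v‖ ^ 2 = v.ofLp ⬝ᵥ v.ofLp := by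
  rw [← inner_eq_dotProduct, real_inner_self_eq_norm_sq]

lemma inner_matVec_of_symm {M : Matrix (Fin n) (Fin n) ℝ} (hM : Mᵀ = M) (v w : E n) :
    inner ℝ (matVec M v) w = inner ℝ v (matVec M w) := by
  rw [inner_eq_dotProduct, inner_eq_dotProduct, ofLp_matVec, ofLp_matVec,
    Matrix.dotProduct_mulVec, ← Matrix.mulVec_transpose, hM]

lemma inner_matVec_nonneg {M : Matrix (Fin n) (Fin n) ℝ} (hM : M.PosSemidef) (v : E n) :
    0 ≤ inner ℝ v (matVec M v) := by
  rw [inner_eq_dotProduct, ofLp_matVec]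
  simpa using hM.dotProduct_mulVec_nonneg v.ofLp

/-- If `0 ⪯ M ⪯ c I` then `‖M v‖² ≤ c ⟨v, M v⟩`. -/
lemma norm_sq_matVec_le {M : Matrix (Fin n) (Fin n) ℝ} {c : ℝ} (hM : M.PosSemidef)
    (hc : (c • (1 : Matrix (Fin n) (Fin n) ℝ) - M).PosSemidef) (v : E n) :
    ‖matVec M v‖ ^ 2 ≤ c * inner ℝ v (matVec M v) := by
  have hs : Mᵀ = M := by simpa using hM.isHermitian.eq
  set w := matVec M v with hw
  set p := inner ℝ v w with hp
  have hp0 : 0 ≤ p := inner_matVec_nonneg hM v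
  have hq : inner ℝ w (matVec M w) ≤ c * ‖w‖ ^ 2 := by
    have := inner_matVec_nonneg hc w
    rw [matVec_sub, matVec_smul, matVec_one, inner_sub_right, inner_smul_right,
      real_inner_self_eq_norm_sq] at this
    linarith
  -- Cauchy-Schwarz for the semidefinite form `⟨·, M ·⟩` at `v` and `w = M v`, by way of the
  -- discriminant: `‖w‖⁴ ≤ ⟨v, M v⟩ ⟨w, M w⟩`.
  have hquad : ∀ t : ℝ, 0 ≤ p * (t * t) + 2 * ‖w‖ ^ 2 * t + inner ℝ w (matVec M w) := by
    intro t
    have h := inner_matVec_nonneg hM (t • v + w)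
    rw [matVec_map_add, matVec_map_smul, ← hw, inner_add_left, inner_add_right, inner_add_right,
      inner_smul_left, inner_smul_left, inner_smul_right, inner_smul_right,
      real_inner_self_eq_norm_sq, ← inner_matVec_of_symm hs v w, ← hw,
      real_inner_self_eq_norm_sq] at h
    simp only [conj_trivial] at h
    linarith
  have hd := discrim_le_zero hquad
  rw [discrim] at hd
  rcases eq_or_lt_of_le (sq_nonneg ‖w‖) with h0 | h0
  · have hw0 : w = 0 := by
      have : ‖w‖ = 0 := by simpa using h0.symm
      simpa using this
    rw [hp, hw0]; simp
  · have h1 : (‖w‖ ^ 2) * (‖w‖ ^ 2) ≤ (‖w‖ ^ 2) * (c * p) := by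
      nlinarith [mul_le_mul_of_nonneg_left hq hp0]
    exact le_of_mul_le_mul_left h1 h0

/-! ### The Frobenius norm -/

section Frobenius
open scoped Matrix.Norms.Frobenius

lemma frobNorm_nonneg (M : Matrix (Fin n) (Fin n) ℝ) : 0 ≤ frobNorm M := norm_nonneg M

lemma frobNorm_add_le (M N : Matrix (Fin n) (Fin n) ℝ) :
    frobNorm (M + N) ≤ frobNorm M + frobNorm N := norm_add_le M N

lemma frobNorm_neg (M : Matrix (Fin n) (Fin n) ℝ) : frobNorm (-M) = frobNorm M := norm_neg M

lemma frobNorm_mul_le (M N : Matrix (Fin n) (Fin n) ℝ) :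
    frobNorm (M * N) ≤ frobNorm M * frobNorm N := Matrix.frobenius_norm_mul M N

lemma norm_matVec_le (M : Matrix (Fin n) (Fin n) ℝ) (v : E n) :
    ‖matVec M v‖ ≤ frobNorm M * ‖v‖ := by
  have h := Matrix.frobenius_norm_mul M (Matrix.replicateCol Unit v.ofLp)
  rw [← Matrix.replicateCol_mulVec, Matrix.frobenius_norm_replicateCol,
    Matrix.frobenius_norm_replicateCol] at h
  exact h

lemma frobNorm_sq (M : Matrix (Fin n) (Fin n) ℝ) : frobNorm M ^ 2 = (M * Mᵀ).trace := by
  rw [frobNorm, Matrix.frobenius_norm_def, ← Real.sqrt_eq_rpow, Real.sq_sqrt]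
  · simp [Matrix.trace, Matrix.mul_apply, sq]
  · positivity

end Frobenius

/-- The matrix `v vᵀ / ‖v‖²` of the orthogonal projection onto the line spanned by `v`
(zero if `v = 0`). -/
def lineProj (v : E n) : Matrix (Fin n) (Fin n) ℝ :=
  (1 / ‖v‖ ^ 2) • Matrix.vecMulVec v.ofLp v.ofLp

lemma lineProj_transpose (v : E n) : (lineProj v)ᵀ = lineProj v := by
  rw [lineProj, transpose_smul, transpose_vecMulVec]

lemma lineProj_mul_self (v : E n) : lineProj v * lineProj v = lineProj v := by
  rcases eq_or_ne v 0 with rfl | hv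
  · simp [lineProj]
  · have hv' : ‖v‖ ^ 2 ≠ 0 := by simpa using hv
    rw [lineProj, smul_mul_smul_comm, vecMulVec_mul_vecMulVec, ← norm_sq_eq_dotProduct,
      vecMulVec_smul, smul_smul]
    congr 1
    field_simp

lemma one_sub_lineProj_mul_self (v : E n) :
    (1 - lineProj v) * (1 - lineProj v) = 1 - lineProj v := by
  rw [mul_sub, sub_mul _ _ (lineProj v), lineProj_mul_self]; simp

lemma matVec_lineProj_self (v : E n) : matVec (lineProj v) v = v := by
  rcases eq_or_ne v 0 with rfl | hv
  · simp
  · have hv' : ‖v‖ ^ 2 ≠ 0 := by simpa using hv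
    ext1
    rw [ofLp_matVec, lineProj, smul_mulVec, vecMulVec_mulVec, ← norm_sq_eq_dotProduct]
    simp only [op_smul_eq_smul, Pi.smul_apply, smul_eq_mul]
    field_simp

lemma trace_mul_lineProj (X : Matrix (Fin n) (Fin n) ℝ) (v : E n) :
    (X * lineProj v * Xᵀ).trace = ‖matVec X v‖ ^ 2 / ‖v‖ ^ 2 := by
  rw [lineProj, mul_smul_comm, smul_mul_assoc, trace_smul, mul_vecMulVec, vecMulVec_mul,
    trace_vecMulVec, norm_sq_eq_dotProduct (matVec X v), ofLp_matVec, vecMul_transpose,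
    smul_eq_mul]
  ring

/-- Compression by the projection `I - P` decreases the squared Frobenius norm by at least
`‖X v‖² / ‖v‖²`, where `P` is the projection onto the line spanned by `v`. -/
lemma frobNorm_sq_compress_le (X : Matrix (Fin n) (Fin n) ℝ) (v : E n) :
    frobNorm ((1 - lineProj v) * X * (1 - lineProj v)) ^ 2
      ≤ frobNorm X ^ 2 - ‖matVec X v‖ ^ 2 / ‖v‖ ^ 2 := by
  set P := lineProj v with hP
  have hPt : Pᵀ = P := lineProj_transpose v
  have hPP : P * P = P := lineProj_mul_self v
  have hQt : (1 - P)ᵀ = 1 - P := by rw [transpose_sub, transpose_one, hPt]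
  have hQQ : (1 - P) * (1 - P) = 1 - P := one_sub_lineProj_mul_self v
  have h1 : frobNorm (X * (1 - P)) ^ 2 = frobNorm X ^ 2 - ‖matVec X v‖ ^ 2 / ‖v‖ ^ 2 := by
    rw [frobNorm_sq, frobNorm_sq, ← trace_mul_lineProj, ← hP, transpose_mul, hQt,
      mul_assoc, ← mul_assoc (1 - P), hQQ, ← trace_sub]
    congr 1
    noncomm_ring
  -- Pythagoras for the complementary projections `P` and `I - P` acting on the left; the first part
  -- is then discarded.
  have h2 : frobNorm (P * (X * (1 - P))) ^ 2 + frobNorm ((1 - P) * (X * (1 - P))) ^ 2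
      = frobNorm (X * (1 - P)) ^ 2 := by
    set Y := X * (1 - P)
    have e1 : frobNorm (P * Y) ^ 2 = (P * (Y * Yᵀ)).trace := by
      rw [frobNorm_sq, transpose_mul, hPt, trace_mul_comm, mul_assoc, ← mul_assoc P P, hPP,
        trace_mul_comm, mul_assoc]
    have e2 : frobNorm ((1 - P) * Y) ^ 2 = ((1 - P) * (Y * Yᵀ)).trace := by
      rw [frobNorm_sq, transpose_mul, hQt, trace_mul_comm, mul_assoc, ← mul_assoc (1 - P) (1 - P),
        hQQ, trace_mul_comm, mul_assoc]
    rw [e1, e2, frobNorm_sq, ← trace_add, ← add_mul]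
    simp
  rw [mul_assoc, ← h1, ← h2]
  nlinarith [sq_nonneg (frobNorm (P * (X * (1 - P))))]

/-! ### BFGS updates in the metric of the Hessian -/

/-- The error `R H R - I` of the inverse Hessian approximation `H` in the metric of the Hessian
`A = R²`. -/
def relErr (R H : Matrix (Fin n) (Fin n) ℝ) : Matrix (Fin n) (Fin n) ℝ := R * H * R - 1

/-- Conjugation by `R` carries both `s` and `R⁻¹ g` to the same vector `v = R s`, since `g = R² s`
and `ρ = 1/‖v‖²`. The oblique factors become `I - P` and the rank-one term becomes `P`, so `(I - P)²
= I - P` absorbs the identity. With `1 / 0 = 0` the degenerate case `v = 0` is included. -/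
lemma relErr_bfgsUpdate {R : Matrix (Fin n) (Fin n) ℝ} (hR : Rᵀ = R)
    (H : Matrix (Fin n) (Fin n) ℝ) (s : E n) :
    relErr R (bfgsUpdate H s (matVec (R * R) s))
      = (1 - lineProj (matVec R s)) * relErr R H * (1 - lineProj (matVec R s)) := by
  set v := matVec R s with hv
  have hρ : inner ℝ (matVec (R * R) s) s = ‖v‖ ^ 2 := by
    rw [matVec_mul, inner_matVec_of_symm hR, real_inner_self_eq_norm_sq]
  have e1 : vecMulVec v.ofLp v.ofLp * R = R * vecMulVec s.ofLp (matVec (R * R) s).ofLp := by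
    rw [vecMulVec_mul, mul_vecMulVec, matVec_mul, ofLp_matVec, ← hv, ← mulVec_transpose, hR]
    rfl
  have e2 : R * vecMulVec v.ofLp v.ofLp = vecMulVec (matVec (R * R) s).ofLp s.ofLp * R := by
    rw [vecMulVec_mul, mul_vecMulVec, matVec_mul, ofLp_matVec, ← hv, ← mulVec_transpose, hR]
    rfl
  have e3 : R * vecMulVec s.ofLp s.ofLp * R = vecMulVec v.ofLp v.ofLp := by
    rw [mul_vecMulVec, vecMulVec_mul, ← mulVec_transpose, hR]
    rfl
  simp only [relErr, bfgsUpdate, hρ]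
  set ρ : ℝ := 1 / ‖v‖ ^ 2
  have hP : lineProj v = ρ • vecMulVec v.ofLp v.ofLp := rfl
  set P := lineProj v
  have l : R * (1 - ρ • vecMulVec s.ofLp (matVec (R * R) s).ofLp) = (1 - P) * R := by
    rw [hP, mul_sub, sub_mul, mul_smul_comm, ← e1, smul_mul_assoc]; simp
  have r : (1 - ρ • vecMulVec (matVec (R * R) s).ofLp s.ofLp) * R = R * (1 - P) := by
    rw [hP, mul_sub, sub_mul, mul_smul_comm, e2, smul_mul_assoc]; simp
  have c : R * (ρ • vecMulVec s.ofLp s.ofLp) * R = P := by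
    rw [mul_smul_comm, smul_mul_assoc, e3, hP]
  calc _ = (R * (1 - ρ • vecMulVec s.ofLp (matVec (R * R) s).ofLp)) * H
          * ((1 - ρ • vecMulVec (matVec (R * R) s).ofLp s.ofLp) * R)
          + R * (ρ • vecMulVec s.ofLp s.ofLp) * R - 1 := by noncomm_ring
    _ = (1 - P) * (R * H * R) * (1 - P) + P - 1 := by rw [l, r, c]; noncomm_ring
    _ = _ := by
      have : (1 - P) * (1 - P) = 1 - P := one_sub_lineProj_mul_self v
      rw [mul_sub (1 - P) (R * H * R) 1, sub_mul _ _ (1 - P), mul_one, this]; abel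

/-- With `Δ` the relative error of `H⁻¹`, `R H R = (I + Δ)⁻¹`, so `X = -(Δ + Δ X)` and `‖X‖ ≤ (1/7)
/ (1 - 1/7) = 1/6`. -/
lemma frobNorm_relErr_inv_le {R H : Matrix (Fin n) (Fin n) ℝ} (hRu : IsUnit R)
    (h : frobNorm (R⁻¹ * (H⁻¹ - R * R) * R⁻¹) ≤ 1 / 7) : frobNorm (relErr R H) ≤ 1 / 6 := by
  have hRd : IsUnit R.det := (Matrix.isUnit_iff_isUnit_det R).1 hRu
  set Δ := R⁻¹ * (H⁻¹ - R * R) * R⁻¹ with hΔ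
  have h1 : R⁻¹ * H⁻¹ * R⁻¹ = 1 + Δ := by
    have : R⁻¹ * (R * R) * R⁻¹ = 1 := by
      rw [← mul_assoc R⁻¹, nonsing_inv_mul _ hRd, one_mul, mul_nonsing_inv _ hRd]
    rw [hΔ, mul_sub, sub_mul, this]; abel
  have hu : IsUnit (1 + Δ) := by
    rw [← Matrix.mulVec_injective_iff_isUnit]
    refine (injective_iff_map_eq_zero (Matrix.mulVecLin (1 + Δ))).2 fun v hv => ?_
    have hv' : matVec (1 + Δ) (WithLp.toLp 2 v) = 0 := by
      ext1; exact congrFun hv _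
    rw [matVec_add, matVec_one, add_eq_zero_iff_eq_neg] at hv'
    have := norm_matVec_le Δ (WithLp.toLp 2 v)
    have h3 : ‖(WithLp.toLp 2 v : E n)‖ = ‖matVec Δ (WithLp.toLp 2 v)‖ := by
      conv_lhs => rw [hv']
      exact norm_neg _
    have h4 : ‖(WithLp.toLp 2 v : E n)‖ = 0 := by
      nlinarith [norm_nonneg (WithLp.toLp 2 v : E n),
        mul_le_mul_of_nonneg_right h (norm_nonneg (WithLp.toLp 2 v : E n))]
    simpa using h4
  -- Invertibility of `H` is not assumed, and the inverse of a singular matrix is `0` by convention.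
  -- It follows here from that of `I + Δ`.
  have hHi : IsUnit H⁻¹ := by
    have e : H⁻¹ = R * (1 + Δ) * R := by
      rw [← h1, mul_assoc R, mul_assoc, mul_assoc, nonsing_inv_mul _ hRd, mul_one, ← mul_assoc,
        mul_nonsing_inv _ hRd, one_mul]
    rw [e]
    exact (hRu.mul hu).mul hRu
  have hHd : IsUnit H.det :=
    (Matrix.isUnit_iff_isUnit_det H).1 (Matrix.isUnit_nonsing_inv_iff.1 hHi)
  have h2 : (1 + Δ) * (R * H * R) = 1 := by
    rw [← h1]
    calc _ = R⁻¹ * (H⁻¹ * ((R⁻¹ * R) * H)) * R := by noncomm_ring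
      _ = 1 := by
        rw [nonsing_inv_mul _ hRd, one_mul, nonsing_inv_mul _ hHd, mul_one,
          nonsing_inv_mul _ hRd]
  have h3 : relErr R H = -(Δ + Δ * relErr R H) := by
    have e : R * H * R = 1 + relErr R H := by rw [relErr]; abel
    rw [e] at h2
    have : Δ + relErr R H + Δ * relErr R H = 0 := by
      have : (1 + Δ) * (1 + relErr R H) = 1 + (Δ + relErr R H + Δ * relErr R H) := by
        noncomm_ring
      rw [this] at h2
      simpa using h2
    rw [eq_neg_iff_add_eq_zero, ← this]; abel
  have h4 : frobNorm (relErr R H) ≤ frobNorm Δ + frobNorm Δ * frobNorm (relErr R H) := by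
    conv_lhs => rw [h3, frobNorm_neg]
    exact (frobNorm_add_le _ _).trans (by gcongr; exact frobNorm_mul_le _ _)
  nlinarith [frobNorm_nonneg (relErr R H),
    mul_le_mul_of_nonneg_right h (frobNorm_nonneg (relErr R H))]

/-! ### Convergence of the inner iterations on a quadratic -/

lemma norm_one_sub_lineProj_le (v w : E n) : ‖matVec (1 - lineProj v) w‖ ≤ ‖w‖ := by
  set Q := 1 - lineProj v with hQ
  have hQt : Qᵀ = Q := by rw [hQ, transpose_sub, transpose_one, lineProj_transpose]
  have h : ‖matVec Q w‖ ^ 2 = inner ℝ w (matVec Q w) := by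
    rw [← real_inner_self_eq_norm_sq, inner_matVec_of_symm hQt, ← matVec_mul,
      one_sub_lineProj_mul_self]
  have h2 := real_inner_le_norm w (matVec Q w)
  rcases eq_or_lt_of_le (norm_nonneg (matVec Q w)) with h0 | h0
  · rw [← h0]; exact norm_nonneg w
  · exact le_of_mul_le_mul_right (by nlinarith) h0

/-- Finite product of the superlinear rates: the geometric mean of the `r t` is at most their
arithmetic mean, and their sum is at most `e 0`. -/
lemma superlinear_of_telescope {e ζ r : ℕ → ℝ} {c : ℝ} (hc : 0 ≤ c) (hr : ∀ t, 0 ≤ r t)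
    (he : ∀ t, 0 ≤ e t) (hζ : 0 ≤ ζ 0) (hstep : ∀ t, e (t + 1) + r t ≤ e t)
    (hζstep : ∀ t, ζ (t + 1) ≤ c * r t * ζ t) (T : ℕ) :
    ζ T ≤ (c * e 0 * (1 / (T : ℝ))) ^ T * ζ 0 := by
  have h1 : ∀ t, ζ t ≤ c ^ t * (∏ i ∈ Finset.range t, r i) * ζ 0 := by
    intro t
    induction t with
    | zero => simp
    | succ t ih =>
      calc ζ (t + 1) ≤ c * r t * ζ t := hζstep t
        _ ≤ c * r t * (c ^ t * (∏ i ∈ Finset.range t, r i) * ζ 0) :=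
          mul_le_mul_of_nonneg_left ih (mul_nonneg hc (hr t))
        _ = _ := by rw [Finset.prod_range_succ, pow_succ]; ring
  have h2 : ∀ t, e t + ∑ i ∈ Finset.range t, r i ≤ e 0 := by
    intro t
    induction t with
    | zero => simp
    | succ t ih => rw [Finset.sum_range_succ]; linarith [hstep t]
  rcases Nat.eq_zero_or_pos T with rfl | hT
  · simp
  have hT' : (0 : ℝ) < T := by exact_mod_cast hT
  have h3 : ∏ i ∈ Finset.range T, r i ≤ (e 0 * (1 / (T : ℝ))) ^ T := by
    have h := Real.geom_mean_le_arith_mean (Finset.range T) (fun _ => (1 : ℝ)) r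
      (fun _ _ => zero_le_one) (by simpa using hT) (fun i _ => hr i)
    simp only [Real.rpow_one, Finset.sum_const, Finset.card_range, nsmul_eq_mul, mul_one,
      one_mul] at h
    have hp : 0 ≤ ∏ i ∈ Finset.range T, r i := Finset.prod_nonneg fun i _ => hr i
    have h4 := pow_le_pow_left₀ (Real.rpow_nonneg hp _) h T
    rw [Real.rpow_inv_natCast_pow hp hT.ne'] at h4
    refine h4.trans (pow_le_pow_left₀ (div_nonneg (Finset.sum_nonneg fun i _ => hr i) hT'.le)
      ?_ T)
    rw [mul_one_div]
    gcongr
    linarith [h2 T, he T]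
  calc ζ T ≤ c ^ T * (∏ i ∈ Finset.range T, r i) * ζ 0 := h1 T
    _ ≤ c ^ T * (e 0 * (1 / (T : ℝ))) ^ T * ζ 0 := by gcongr
    _ = _ := by rw [← mul_pow, mul_assoc c]

/-- For `‖X‖ ≤ 1/6` and `w = z + X z`, the ratio `‖X z‖ / ‖z‖` is controlled by
`‖X w‖ / ‖w‖`. -/
lemma norm_sq_matVec_le_ratio {X : Matrix (Fin n) (Fin n) ℝ} (hX : frobNorm X ≤ 1 / 6)
    (z : E n) :
    ‖matVec X z‖ ^ 2 ≤ 49 / 25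
      * (‖matVec X (z + matVec X z)‖ ^ 2 / ‖z + matVec X z‖ ^ 2) * ‖z‖ ^ 2 := by
  set w := z + matVec X z with hw
  have hbd : ∀ v : E n, ‖matVec X v‖ ≤ 1 / 6 * ‖v‖ := fun v =>
    (norm_matVec_le X v).trans (mul_le_mul_of_nonneg_right hX (norm_nonneg v))
  -- The constant `49/25` is `(6/5 · 7/6)²`: here `X z = X w - X (X z)` gives `(1 - 1/6) ‖X z‖ ≤ ‖X
  -- w‖`, and below `‖w‖ ≤ (1 + 1/6) ‖z‖`.
  have h1 : ‖matVec X z‖ ≤ 6 / 5 * ‖matVec X w‖ := by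
    have e : matVec X z = matVec X w - matVec X (matVec X z) := by
      rw [hw, matVec_map_add]; abel
    have := norm_sub_le (matVec X w) (matVec X (matVec X z))
    rw [← e] at this
    linarith [hbd (matVec X z)]
  have h2 : ‖w‖ ≤ 7 / 6 * ‖z‖ := (norm_add_le _ _).trans (by linarith [hbd z])
  rcases eq_or_ne w 0 with h0 | h0
  · rw [h0] at h1
    simp only [matVec_map_zero, norm_zero, mul_zero] at h1
    have : ‖matVec X z‖ = 0 := le_antisymm h1 (norm_nonneg _)
    rw [this, zero_pow two_ne_zero]; positivity
  · have hw0 : 0 < ‖w‖ := norm_pos_iff.2 h0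
    rw [mul_div_assoc', div_mul_eq_mul_div, le_div_iff₀ (by positivity)]
    have h3 := mul_le_mul h1 h2 (norm_nonneg _) (by positivity)
    have h4 := pow_le_pow_left₀ (mul_nonneg (norm_nonneg _) (norm_nonneg _)) h3 2
    nlinarith

section Quadratic

variable {R : Matrix (Fin n) (Fin n) ℝ} {x ystar : E n}

lemma matVec_relErr (H : Matrix (Fin n) (Fin n) ℝ) (v : E n) :
    matVec (relErr R H) v = matVec R (matVec H (matVec R v)) - v := by
  rw [relErr, matVec_sub, matVec_one, matVec_mul, matVec_mul]

/-- With `b = A⁻¹d`, this expresses the error of the linear solve in the `A`-norm through `X` alone.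
-/
lemma matVec_matVec_sub (H : Matrix (Fin n) (Fin n) ℝ) {d b : E n}
    (hb : matVec (R * R) b = d) :
    matVec R (matVec H d - b) = matVec (relErr R H) (matVec R b) := by
  rw [matVec_relErr, ← hb, matVec_map_sub, matVec_mul R R]

lemma frobNorm_relErr_bfgsUpdate_sq_le (hR : Rᵀ = R) (H : Matrix (Fin n) (Fin n) ℝ) (s : E n) :
    frobNorm (relErr R (bfgsUpdate H s (matVec (R * R) s))) ^ 2
      ≤ frobNorm (relErr R H) ^ 2
        - ‖matVec (relErr R H) (matVec R s)‖ ^ 2 / ‖matVec R s‖ ^ 2 := by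
  rw [relErr_bfgsUpdate hR]
  exact frobNorm_sq_compress_le _ _

lemma frobNorm_relErr_bfgsUpdate_le (hR : Rᵀ = R) (H : Matrix (Fin n) (Fin n) ℝ) (s : E n) :
    frobNorm (relErr R (bfgsUpdate H s (matVec (R * R) s))) ≤ frobNorm (relErr R H) := by
  refine (sq_le_sq₀ (frobNorm_nonneg _) (frobNorm_nonneg _)).1 ?_
  have h := frobNorm_relErr_bfgsUpdate_sq_le hR H s
  have : 0 ≤ ‖matVec (relErr R H) (matVec R s)‖ ^ 2 / ‖matVec R s‖ ^ 2 := by positivity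
  linarith

/-- A unit quasi-Newton step on a quadratic with Hessian `R²`. -/
lemma qnStep_quadratic (hR : Rᵀ = R) (hx : matVec (R * R) ystar = x) (σ : QNState n)
    (hσ : frobNorm (relErr R σ.H) ≤ 1 / 6) :
    ∃ r : ℝ, 0 ≤ r ∧
      frobNorm (relErr R (qnStep (fun y => matVec (R * R) y - x) 1 σ).H) ^ 2 + r
        ≤ frobNorm (relErr R σ.H) ^ 2 ∧
      ‖matVec R ((qnStep (fun y => matVec (R * R) y - x) 1 σ).y - ystar)‖ ^ 2
        ≤ 49 / 25 * r * ‖matVec R (σ.y - ystar)‖ ^ 2 := by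
  set z := matVec R (σ.y - ystar) with hz
  set s : E n := -matVec σ.H (matVec R z) with hs
  have hgrad : matVec (R * R) σ.y - x = matVec R z := by
    rw [← hx, ← matVec_map_sub, matVec_mul]
  have hy : (qnStep (fun y => matVec (R * R) y - x) 1 σ).y = σ.y + s := by
    simp only [qnStep, hgrad, one_smul, hs]; abel
  have hH : (qnStep (fun y => matVec (R * R) y - x) 1 σ).H
      = bfgsUpdate σ.H s (matVec (R * R) s) := by
    change bfgsUpdate σ.H ((qnStep (fun y => matVec (R * R) y - x) 1 σ).y - σ.y)
      (matVec (R * R) (qnStep (fun y => matVec (R * R) y - x) 1 σ).y - x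
        - (matVec (R * R) σ.y - x)) = _
    rw [hy, sub_sub_sub_cancel_right, ← matVec_map_sub, add_sub_cancel_left]
  have hRs : matVec R s = -(z + matVec (relErr R σ.H) z) := by
    rw [matVec_relErr, hs, matVec_map_neg]; abel
  have h1 := frobNorm_relErr_bfgsUpdate_sq_le hR σ.H s
  have h2 := norm_sq_matVec_le_ratio hσ z
  rw [hRs, matVec_map_neg (relErr R σ.H), norm_neg, norm_neg] at h1
  -- The witness `r` is the guaranteed drop of `‖X‖_F²`. Since `R s = -(z + X z)`, the new scaled
  -- error `z + R s` is `-X z`, to which the ratio bound applies.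
  refine ⟨_, div_nonneg (sq_nonneg ‖matVec (relErr R σ.H) (z + matVec (relErr R σ.H) z)‖)
    (sq_nonneg ‖z + matVec (relErr R σ.H) z‖), ?_, ?_⟩
  · rw [hH]; linarith
  · have e : matVec R (σ.y + s - ystar) = -matVec (relErr R σ.H) z := by
      rw [add_sub_right_comm, matVec_map_add, ← hz, hRs]; abel
    rw [hy, e, norm_neg]
    exact h2

/-- Superlinear convergence of BFGS on a quadratic with Hessian `R²`. -/
theorem bfgs_superlinear (hR : Rᵀ = R) (hx : matVec (R * R) ystar = x) (σ : QNState n)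
    (hσ : frobNorm (relErr R σ.H) ≤ 1 / 6) (T : ℕ) :
    frobNorm (relErr R ((qnStep (fun y => matVec (R * R) y - x) 1)^[T] σ).H) ≤ 1 / 6 ∧
    ‖matVec R (((qnStep (fun y => matVec (R * R) y - x) 1)^[T] σ).y - ystar)‖ ^ 2
      ≤ (1 / (T : ℝ)) ^ T * ‖matVec R (σ.y - ystar)‖ ^ 2 := by
  set S := fun t : ℕ => (qnStep (fun y => matVec (R * R) y - x) 1)^[t] σ with hS
  have hsucc : ∀ t, S (t + 1) = qnStep (fun y => matVec (R * R) y - x) 1 (S t) :=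
    fun t => Function.iterate_succ_apply' _ t σ
  have hE : ∀ t, frobNorm (relErr R (S t).H) ≤ 1 / 6 := by
    intro t
    induction t with
    | zero => exact hσ
    | succ t ih =>
      obtain ⟨r, hr, h1, -⟩ := qnStep_quadratic hR hx (S t) ih
      rw [← hsucc] at h1
      refine le_trans ?_ ih
      exact (sq_le_sq₀ (frobNorm_nonneg _) (frobNorm_nonneg _)).1 (by linarith)
  refine ⟨hE T, ?_⟩
  choose r hr h1 h2 using fun t => qnStep_quadratic hR hx (S t) (hE t)
  simp only [← hsucc] at h1 h2
  have h := superlinear_of_telescope (e := fun t => frobNorm (relErr R (S t).H) ^ 2)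
    (ζ := fun t => ‖matVec R ((S t).y - ystar)‖ ^ 2) (c := 49 / 25) (by norm_num) hr
    (fun t => sq_nonneg _) (sq_nonneg _) h1 h2 T
  refine h.trans (mul_le_mul_of_nonneg_right (pow_le_pow_left₀ (by positivity) ?_ T)
    (sq_nonneg _))
  -- The factor per step is `49/25 · 1/36 · 1/T`, which is below `1/T`.
  have h0 : frobNorm (relErr R (S 0).H) ^ 2 ≤ (1 / 6) ^ 2 :=
    pow_le_pow_left₀ (frobNorm_nonneg _) (hE 0) 2
  have hT : (0 : ℝ) ≤ 1 / (T : ℝ) := by positivity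
  nlinarith [mul_le_mul_of_nonneg_right h0 hT]

/-- The matrices of subroutine `ℬ` approximate the action of the inverse Hessian on `d` at a
linear rate. -/
lemma subroutineBMatrix_quadratic (hR : Rᵀ = R) {H₀ : Matrix (Fin n) (Fin n) ℝ}
    (hH₀ : frobNorm (relErr R H₀) ≤ 1 / 6) (y : E n) {d b : E n}
    (hb : matVec (R * R) b = d) {ξ : ℕ → ℝ} (hξ : ∀ i, 0 < ξ i) (i : ℕ) :
    frobNorm (relErr R (subroutineBMatrix (fun y => matVec (R * R) y - x) y H₀ d ξ i)) ≤ 1 / 6 ∧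
    ‖matVec (relErr R (subroutineBMatrix (fun y => matVec (R * R) y - x) y H₀ d ξ i))
        (matVec R b)‖ ≤ (1 / 6) ^ (i + 1) * ‖matVec R b‖ := by
  induction i with
  | zero =>
    refine ⟨hH₀, (norm_matVec_le _ _).trans ?_⟩
    rw [zero_add, pow_one]
    exact mul_le_mul_of_nonneg_right hH₀ (norm_nonneg _)
  | succ i ih =>
    set H := subroutineBMatrix (fun y => matVec (R * R) y - x) y H₀ d ξ i with hH
    set s : E n := ξ i • matVec H d with hs
    have hsucc : subroutineBMatrix (fun y => matVec (R * R) y - x) y H₀ d ξ (i + 1)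
        = bfgsUpdate H s (matVec (R * R) s) := by
      change bfgsUpdate H s (matVec (R * R) (y + s) - x - (matVec (R * R) y - x)) = _
      rw [sub_sub_sub_cancel_right, ← matVec_map_sub, add_sub_cancel_left]
    rw [hsucc]
    refine ⟨(frobNorm_relErr_bfgsUpdate_le hR H s).trans ih.1, ?_⟩
    set X := relErr R H with hX
    set w := matVec R b with hw
    set Q := 1 - lineProj (matVec R s) with hQ
    have hQs : matVec Q (matVec R s) = 0 := by
      rw [hQ, matVec_sub, matVec_one, matVec_lineProj_self, sub_self]
    have hRs : matVec R s = ξ i • (w + matVec X w) := by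
      rw [hs, matVec_map_smul, hX, matVec_relErr, ← hb, matVec_mul R R]
      congr 1; abel
    -- The projection kills `R s`, a positive multiple of `w + X w`. So the new error `Q X Q`
    -- applied to `w` is `-Q X Q (X w)`: one extra factor `‖X‖ ≤ 1/6` on the previous `‖X w‖`.
    have hQw : matVec Q w = -matVec Q (matVec X w) := by
      rw [hRs, matVec_map_smul] at hQs
      have := (smul_eq_zero.1 hQs).resolve_left (hξ i).ne'
      rw [matVec_map_add] at this
      exact eq_neg_of_add_eq_zero_left this
    rw [relErr_bfgsUpdate hR, ← hX, ← hQ, matVec_mul, matVec_mul, hQw, matVec_map_neg,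
      matVec_map_neg, norm_neg]
    calc ‖matVec Q (matVec X (matVec Q (matVec X w)))‖
        ≤ ‖matVec X (matVec Q (matVec X w))‖ := norm_one_sub_lineProj_le _ _
      _ ≤ frobNorm X * ‖matVec Q (matVec X w)‖ := norm_matVec_le _ _
      _ ≤ 1 / 6 * ‖matVec X w‖ :=
        mul_le_mul ih.1 (norm_one_sub_lineProj_le _ _) (norm_nonneg _) (by norm_num)
      _ ≤ 1 / 6 * ((1 / 6) ^ (i + 1) * ‖w‖) := by gcongr; exact ih.2
      _ = _ := by rw [pow_succ _ (i + 1)]; ring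

end Quadratic

/-- Trades the geometric rate for the `1/Q` of the final bound, by `Q ≤ 36^(Q-1)`. -/
lemma inv_six_pow_sq_le {Q : ℕ} (hQ : 1 ≤ Q) : ((1 / 6 : ℝ) ^ Q) ^ 2 ≤ 1 / (36 * (Q : ℝ)) := by
  have h : ∀ m : ℕ, ((1 / 6 : ℝ) ^ (m + 1)) ^ 2 ≤ 1 / (36 * ((m + 1 : ℕ) : ℝ)) := by
    intro m
    have h1 : ((m + 1 : ℕ) : ℝ) ≤ 36 ^ m := by
      have : m + 1 ≤ 36 ^ m := Nat.lt_pow_self (by norm_num)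
      exact_mod_cast this
    have e : ((1 / 6 : ℝ) ^ (m + 1)) ^ 2 = 1 / (36 * 36 ^ m) := by
      rw [← pow_mul, mul_comm, pow_mul, pow_succ]
      norm_num [mul_comm, div_pow]
    rw [e]
    gcongr
  obtain ⟨m, rfl⟩ := Nat.exists_eq_add_of_le' hQ
  exact h m

/-! ### Spectral bounds and the warm-up gradient steps -/

section Bounds

variable {A : Matrix (Fin n) (Fin n) ℝ} {μ L : ℝ}

lemma mul_norm_sq_le_inner (h : (A - μ • (1 : Matrix (Fin n) (Fin n) ℝ)).PosSemidef) (v : E n) :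
    μ * ‖v‖ ^ 2 ≤ inner ℝ v (matVec A v) := by
  have := inner_matVec_nonneg h v
  rw [matVec_sub, matVec_smul, matVec_one, inner_sub_right, inner_smul_right,
    real_inner_self_eq_norm_sq] at this
  linarith

lemma inner_le_mul_norm_sq (h : (L • (1 : Matrix (Fin n) (Fin n) ℝ) - A).PosSemidef) (v : E n) :
    inner ℝ v (matVec A v) ≤ L * ‖v‖ ^ 2 := by
  have := inner_matVec_nonneg h v
  rw [matVec_sub, matVec_smul, matVec_one, inner_sub_right, inner_smul_right,
    real_inner_self_eq_norm_sq] at this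
  linarith

lemma mul_norm_le_norm_matVec (h : (A - μ • (1 : Matrix (Fin n) (Fin n) ℝ)).PosSemidef)
    (v : E n) : μ * ‖v‖ ≤ ‖matVec A v‖ := by
  have h1 := mul_norm_sq_le_inner h v
  have h2 := real_inner_le_norm v (matVec A v)
  rcases eq_or_lt_of_le (norm_nonneg v) with h0 | h0
  · rw [← h0]; simp
  · exact le_of_mul_le_mul_left (by nlinarith) h0

/-- A gradient step contracts by `1 - βμ`. -/
lemma norm_gradient_step_le (hμ : 0 < μ) (hμL : μ ≤ L)
    (hAμ : (A - μ • (1 : Matrix (Fin n) (Fin n) ℝ)).PosSemidef)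
    (hAL : (L • (1 : Matrix (Fin n) (Fin n) ℝ) - A).PosSemidef)
    {β : ℝ} (hβ : 0 < β) (hβ' : β ≤ 2 / (μ + L)) (v : E n) :
    ‖v - β • matVec A v‖ ≤ (1 - β * μ) * ‖v‖ := by
  have hβL : β * (μ + L) ≤ 2 := by rwa [le_div_iff₀ (by linarith)] at hβ'
  have h1β : 0 ≤ 1 - β * μ := by nlinarith
  refine (sq_le_sq₀ (norm_nonneg _) (by positivity)).1 ?_
  -- Split `A = μ I + M` with `0 ⪯ M ⪯ (L - μ) I`. In `‖(1 - βμ) v - β M v‖²` the term `β² ‖M v‖² ≤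
  -- β² (L - μ) ⟨v, M v⟩` is absorbed by the cross term precisely because `β (μ + L) ≤ 2`.
  have hc : ((L - μ) • (1 : Matrix (Fin n) (Fin n) ℝ)
      - (A - μ • (1 : Matrix (Fin n) (Fin n) ℝ))).PosSemidef := by
    rw [sub_smul]
    convert hAL using 1
    abel
  have h := norm_sq_matVec_le hAμ hc v
  set w := matVec (A - μ • (1 : Matrix (Fin n) (Fin n) ℝ)) v with hw
  have hp : 0 ≤ inner ℝ v w := inner_matVec_nonneg hAμ v
  have e : v - β • matVec A v = (1 - β * μ) • v - β • w := by
    rw [hw, matVec_sub, matVec_smul, matVec_one]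
    module
  rw [e, norm_sub_sq_real, norm_smul, norm_smul, inner_smul_left, inner_smul_right,
    Real.norm_of_nonneg h1β, Real.norm_of_nonneg hβ.le, conj_trivial]
  have h3 : β ^ 2 * ‖w‖ ^ 2 ≤ β ^ 2 * ((L - μ) * inner ℝ v w) :=
    mul_le_mul_of_nonneg_left h (sq_nonneg β)
  have h4 : β * (L - μ) ≤ 2 * (1 - β * μ) := by linarith
  have h5 := mul_le_mul_of_nonneg_right h4 (mul_nonneg hβ.le hp)
  nlinarith

lemma norm_warmUp_sub_le (hμ : 0 < μ) (hμL : μ ≤ L)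
    (hAμ : (A - μ • (1 : Matrix (Fin n) (Fin n) ℝ)).PosSemidef)
    (hAL : (L • (1 : Matrix (Fin n) (Fin n) ℝ) - A).PosSemidef)
    {β : ℝ} (hβ : 0 < β) (hβ' : β ≤ 2 / (μ + L)) {x ystar : E n} (hx : matVec A ystar = x)
    (P : ℕ) (y : E n) :
    ‖warmUp (fun y => matVec A y - x) β P y - ystar‖ ≤ (1 - β * μ) ^ P * ‖y - ystar‖ := by
  have h1β : 0 ≤ 1 - β * μ := by
    have : β * (μ + L) ≤ 2 := by rwa [le_div_iff₀ (by linarith)] at hβ'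
    nlinarith
  induction P with
  | zero => simp [warmUp]
  | succ P ih =>
    have e : warmUp (fun y => matVec A y - x) β (P + 1) y - ystar
        = (warmUp (fun y => matVec A y - x) β P y - ystar)
          - β • matVec A (warmUp (fun y => matVec A y - x) β P y - ystar) := by
      rw [matVec_map_sub, hx, warmUp, Function.iterate_succ_apply', warmUp]
      abel
    rw [e, pow_succ, mul_comm _ (1 - β * μ), mul_assoc]
    exact (norm_gradient_step_le hμ hμL hAμ hAL hβ hβ' _).trans
      (mul_le_mul_of_nonneg_left ih h1β)

end Bounds

/-! ### The square root of the Hessian -/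

section Sqrt
open scoped MatrixOrder

lemma exists_sqrt_relErr_le {A H : Matrix (Fin n) (Fin n) ℝ} (hA : A.PosDef)
    (h : relFrobDist H⁻¹ A ≤ 1 / 7) :
    ∃ R : Matrix (Fin n) (Fin n) ℝ, Rᵀ = R ∧ R * R = A ∧ frobNorm (relErr R H) ≤ 1 / 6 := by
  have hA0 : 0 ≤ A := Matrix.nonneg_iff_posSemidef.2 hA.posSemidef
  have hRR : CFC.sqrt A * CFC.sqrt A = A := CFC.sqrt_mul_sqrt_self A hA0
  have hR : (CFC.sqrt A)ᵀ = CFC.sqrt A := by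
    simpa using (Matrix.nonneg_iff_posSemidef.1 (CFC.sqrt_nonneg A)).isHermitian.eq
  have hu : IsUnit (CFC.sqrt A) := by
    have := hA.isUnit
    rw [← hRR] at this
    exact isUnit_of_mul_isUnit_left this
  refine ⟨CFC.sqrt A, hR, hRR, frobNorm_relErr_inv_le hu ?_⟩
  rw [hRR]
  exact h

end Sqrt

/-! ### The quadratic lower-level problem -/

section Lower

variable {A : Matrix (Fin n) (Fin n) ℝ}

lemma hasGradientAt_quadLower (hA : Aᵀ = A) (x y : E n) :
    HasGradientAt (fun y' => quadLower A x y') (matVec A y - x) y := by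
  rw [hasGradientAt_iff_hasFDerivAt]
  have h1 : HasFDerivAt (fun y' : E n => (inner ℝ y' (matVec A y') : ℝ)) _ y :=
    (hasFDerivAt_id y).inner ℝ (Matrix.toEuclideanCLM (n := Fin n) (𝕜 := ℝ) A).hasFDerivAt
  have h2 : HasFDerivAt (fun y' : E n => (inner ℝ y' x : ℝ)) _ y :=
    (hasFDerivAt_id y).inner ℝ (hasFDerivAt_const x y)
  refine ((h1.const_mul (1 / 2)).sub h2).congr_fderiv ?_
  ext v
  have e : inner ℝ y (matVec A v) = inner ℝ v (matVec A y) := by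
    rw [← inner_matVec_of_symm hA, real_inner_comm]
  have e' : inner ℝ y ((Matrix.toEuclideanCLM (n := Fin n) (𝕜 := ℝ) A) v)
      = inner ℝ v (matVec A y) := e
  simp only [id, _root_.sub_apply, _root_.smul_apply,
    ContinuousLinearMap.comp_apply, ContinuousLinearMap.prod_apply, fderivInnerCLM_apply,
    ContinuousLinearMap.id_apply, _root_.zero_apply, inner_zero_right,
    InnerProductSpace.toDual_apply_apply, smul_eq_mul, e', real_inner_comm v,
    inner_sub_right]
  ring

lemma gradY_quadLower (hA : Aᵀ = A) (x : E n) :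
    gradY (quadLower A) x = fun y => matVec A y - x :=
  funext fun y => (hasGradientAt_quadLower hA x y).gradient

lemma hessYYMatrix_quadLower (hA : Aᵀ = A) (x y : E n) :
    hessYYMatrix (quadLower A) x y = A := by
  have h : hessYY (quadLower A) x y = Matrix.toEuclideanCLM (n := Fin n) (𝕜 := ℝ) A := by
    rw [hessYY, gradY_quadLower hA]
    exact ((Matrix.toEuclideanCLM (n := Fin n) (𝕜 := ℝ) A).hasFDerivAt.sub_const x).fderiv
  rw [hessYYMatrix, h, StarAlgEquiv.symm_apply_apply]

lemma hessXY_quadLower (hA : Aᵀ = A) (x y : E n) :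
    hessXY (quadLower A) x y = -ContinuousLinearMap.id ℝ (E n) := by
  have h : (fun x' => gradY (quadLower A) x' y) = fun x' => matVec A y - x' :=
    funext fun x' => congrFun (gradY_quadLower hA x') y
  rw [hessXY, h]
  exact ((hasFDerivAt_id x).const_sub (matVec A y)).fderiv

lemma matVec_mul_inv (hA : A.PosDef) (v : E n) : matVec A (matVec A⁻¹ v) = v := by
  rw [← matVec_mul, mul_nonsing_inv _ ((Matrix.isUnit_iff_isUnit_det A).1 hA.isUnit), matVec_one]

lemma matVec_inv_mul (hA : A.PosDef) (v : E n) : matVec A⁻¹ (matVec A v) = v := by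
  rw [← matVec_mul, nonsing_inv_mul _ ((Matrix.isUnit_iff_isUnit_det A).1 hA.isUnit), matVec_one]

lemma transpose_eq_of_posDef (hA : A.PosDef) : Aᵀ = A := by
  simpa using hA.isHermitian.eq

/-- The gap is `½ ⟨z - y, A (z - y)⟩` with `y = A⁻¹x`. -/
lemma quadLower_min (hA : A.PosDef) (x z : E n) :
    quadLower A x (matVec A⁻¹ x) ≤ quadLower A x z := by
  set y := matVec A⁻¹ x with hy
  have hAy : matVec A y = x := matVec_mul_inv hA x
  have h := inner_matVec_nonneg hA.posSemidef (z - y)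
  have e : inner ℝ y (matVec A z) = inner ℝ z x := by
    rw [← inner_matVec_of_symm (transpose_eq_of_posDef hA), hAy, real_inner_comm]
  rw [matVec_map_sub, hAy, inner_sub_left, inner_sub_right, inner_sub_right, e] at h
  change 1 / 2 * inner ℝ y (matVec A y) - inner ℝ y x
    ≤ 1 / 2 * inner ℝ z (matVec A z) - inner ℝ z x
  rw [hAy]
  linarith

/-- `lowerSol` is an unspecified choice of minimizer. One exists, and any minimizer is a critical
point, hence solves `A y = x`. -/
lemma lowerSol_quadLower (hA : A.PosDef) (x : E n) :
    lowerSol (quadLower A) x = matVec A⁻¹ x := by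
  have hs : ∀ z, quadLower A x (lowerSol (quadLower A) x) ≤ quadLower A x z :=
    Classical.epsilon_spec (p := fun y => ∀ z, quadLower A x y ≤ quadLower A x z)
      ⟨matVec A⁻¹ x, quadLower_min hA x⟩
  have hg := hasGradientAt_quadLower (transpose_eq_of_posDef hA) x (lowerSol (quadLower A) x)
  have h0 : IsLocalMin (fun y' => quadLower A x y') (lowerSol (quadLower A) x) :=
    Filter.Eventually.of_forall hs
  have h1 := h0.hasFDerivAt_eq_zero (hasGradientAt_iff_hasFDerivAt.1 hg)
  have h2 : matVec A (lowerSol (quadLower A) x) - x = 0 :=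
    (InnerProductSpace.toDual ℝ (E n)).map_eq_zero_iff.1 h1
  rw [← sub_eq_zero.1 h2, matVec_inv_mul hA, sub_eq_zero.1 h2]

end Lower

/-! ### The reduced objective -/

/-- Chain rule along `x ↦ (x, B x)`; symmetry of `B` makes the adjoint in the second term `B`
itself. -/
lemma hasGradientAt_comp_graph {F : E n → E n → ℝ}
    (hF : Differentiable ℝ (Function.uncurry F)) {B : Matrix (Fin n) (Fin n) ℝ} (hB : Bᵀ = B)
    (x : E n) :
    HasGradientAt (fun x => F x (matVec B x))
      (gradX F x (matVec B x) + matVec B (gradY F x (matVec B x))) x := by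
  set T := Matrix.toEuclideanCLM (n := Fin n) (𝕜 := ℝ) B
  set y := matVec B x with hy
  have hFd := (hF (x, y)).hasFDerivAt
  set F' := fderiv ℝ (Function.uncurry F) (x, y)
  have hX : HasFDerivAt (fun x' => F x' y) (F'.comp (ContinuousLinearMap.inl ℝ (E n) (E n))) x :=
    HasFDerivAt.comp (g := Function.uncurry F) (f := fun x' => (x', y)) x hFd
      (hasFDerivAt_prodMk_left x y)
  have hY : HasFDerivAt (fun y' => F x y') (F'.comp (ContinuousLinearMap.inr ℝ (E n) (E n))) y :=
    HasFDerivAt.comp (g := Function.uncurry F) (f := fun y' => (x, y')) y hFd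
      (hasFDerivAt_prodMk_right x y)
  have hc : HasFDerivAt (fun x => F x (matVec B x))
      (F'.comp ((ContinuousLinearMap.id ℝ (E n)).prod T)) x :=
    HasFDerivAt.comp (g := Function.uncurry F) (f := fun x' => (x', matVec B x')) x hFd
      ((hasFDerivAt_id x).prodMk T.hasFDerivAt)
  rw [hasGradientAt_iff_hasFDerivAt]
  refine hc.congr_fderiv ?_
  ext v
  have e1 : inner ℝ (gradX F x y) v = F' (v, 0) := by
    rw [gradX, inner_gradient_left, hX.fderiv]; rfl
  have e2 : inner ℝ (matVec B (gradY F x y)) v = F' (0, matVec B v) := by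
    rw [inner_matVec_of_symm hB, gradY, inner_gradient_left, hY.fderiv]; rfl
  have e3 : F' (v, matVec B v) = F' (v, 0) + F' (0, matVec B v) := by
    rw [← map_add]; simp
  rw [InnerProductSpace.toDual_apply_apply, inner_add_left, e1, e2, ← e3]
  rfl

/-- The descent lemma. -/
lemma descent_of_lipschitz_gradient {V : Type*} [NormedAddCommGroup V] [InnerProductSpace ℝ V]
    [CompleteSpace V] {φ : V → ℝ} {g : V → V} {L : ℝ}
    (hg : ∀ x, HasGradientAt φ (g x) x) (hL : ∀ x x', ‖g x - g x'‖ ≤ L * ‖x - x'‖) (x h : V) :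
    φ (x + h) ≤ φ x + inner ℝ (g x) h + L / 2 * ‖h‖ ^ 2 := by
  -- The function along the segment minus its quadratic upper model. The Lipschitz bound makes `ψ' ≤
  -- 0` inside `[0, 1]`, and the claim is `ψ 1 ≤ ψ 0`.
  set ψ : ℝ → ℝ := fun t => φ (x + t • h) - t * inner ℝ (g x) h - L / 2 * ‖h‖ ^ 2 * t ^ 2
    with hψ
  have hd : ∀ t, HasDerivAt ψ
      (inner ℝ (g (x + t • h)) h - inner ℝ (g x) h - L * ‖h‖ ^ 2 * t) t := by
    intro t
    have h1 : HasDerivAt (fun t : ℝ => x + t • h) h t := by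
      simpa using ((hasDerivAt_id t).smul_const h).const_add x
    have h2 : HasDerivAt (fun t : ℝ => φ (x + t • h)) (inner ℝ (g (x + t • h)) h) t := by
      refine ((hg (x + t • h)).hasFDerivAt.comp_hasDerivAt t h1).congr_deriv ?_
      rw [InnerProductSpace.toDual_apply_apply]
    have h3 : HasDerivAt (fun t : ℝ => t * inner ℝ (g x) h) (inner ℝ (g x) h) t := by
      simpa using (hasDerivAt_id t).mul_const (inner ℝ (g x) h)
    have h4 : HasDerivAt (fun t : ℝ => L / 2 * ‖h‖ ^ 2 * t ^ 2) (L * ‖h‖ ^ 2 * t) t := by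
      refine ((hasDerivAt_pow 2 t).const_mul (L / 2 * ‖h‖ ^ 2)).congr_deriv ?_
      norm_num
      ring
    exact (h2.sub h3).sub h4
  have hanti : AntitoneOn ψ (Set.Icc 0 1) := by
    refine antitoneOn_of_deriv_nonpos (convex_Icc 0 1)
      (fun t _ => (hd t).continuousAt.continuousWithinAt)
      (fun t _ => (hd t).differentiableAt.differentiableWithinAt) fun t ht => ?_
    rw [interior_Icc] at ht
    rw [(hd t).deriv, ← inner_sub_left]
    have h1 := real_inner_le_norm (g (x + t • h) - g x) h
    have h2 := hL (x + t • h) x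
    rw [add_sub_cancel_left, norm_smul, Real.norm_of_nonneg ht.1.le] at h2
    nlinarith [mul_le_mul_of_nonneg_right h2 (norm_nonneg h)]
  have := hanti (Set.left_mem_Icc.2 zero_le_one) (Set.right_mem_Icc.2 zero_le_one) zero_le_one
  simp only [hψ, one_smul, zero_smul, add_zero] at this
  linarith

lemma Constants.D_nonneg (c : Constants) : 0 ≤ c.D := by
  rw [Constants.D]; positivity

lemma Constants.C_nonneg (c : Constants) : 0 ≤ c.C := by
  rw [Constants.C]; positivity

lemma Constants.LPhi_nonneg (c : Constants) : 0 ≤ c.LPhi := by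
  rw [Constants.LPhi]
  have := c.C_nonneg
  positivity

/-! ### Inexact gradient descent -/

section InnerProduct

variable {V : Type*} [NormedAddCommGroup V] [InnerProductSpace ℝ V]

lemma norm_add_sq_le_young {ε : ℝ} (hε : 0 < ε) (v w : V) :
    ‖v + w‖ ^ 2 ≤ (1 + ε) * ‖v‖ ^ 2 + (1 + 1 / ε) * ‖w‖ ^ 2 := by
  have h1 := real_inner_le_norm v w
  have h2 : 2 * (‖v‖ * ‖w‖) ≤ ε * ‖v‖ ^ 2 + 1 / ε * ‖w‖ ^ 2 := by
    have h : 0 ≤ 1 / ε * (ε * ‖v‖ - ‖w‖) ^ 2 := by positivity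
    have e : 1 / ε * (ε * ‖v‖ - ‖w‖) ^ 2
        = ε * ‖v‖ ^ 2 + 1 / ε * ‖w‖ ^ 2 - 2 * (‖v‖ * ‖w‖) := by
      field_simp
      ring
    linarith
  rw [norm_add_sq_real]
  linarith

lemma norm_add_sq_le_two (v w : V) : ‖v + w‖ ^ 2 ≤ 2 * ‖v‖ ^ 2 + 2 * ‖w‖ ^ 2 := by
  have := norm_add_sq_le_young one_pos v w
  norm_num at this
  exact this

lemma norm_add_add_sq_le (u v w : V) :
    ‖u + v + w‖ ^ 2 ≤ 3 * (‖u‖ ^ 2 + ‖v‖ ^ 2 + ‖w‖ ^ 2) := by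
  have h1 := norm_add_sq_le_young (show (0 : ℝ) < 1 / 2 by norm_num) (u + v) w
  have h2 := norm_add_sq_le_two u v
  norm_num at h1
  linarith

/-- In the descent lemma, `-⟨g, r⟩ ≤ (‖g‖² + ‖r‖²) / 2` gives the two terms `α/2`, and `‖g + r‖² ≤
2‖g‖² + 2‖r‖²` gives the two terms `α² L`. -/
lemma inexact_gradient_step [CompleteSpace V] {φ : V → ℝ} {g : V → V} {L α : ℝ}
    (hg : ∀ x, HasGradientAt φ (g x) x) (hL : ∀ x x', ‖g x - g x'‖ ≤ L * ‖x - x'‖)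
    (hL0 : 0 ≤ L) (hα : 0 < α) (x r : V) :
    φ (x - α • (g x + r))
      ≤ φ x - (α / 2 - α ^ 2 * L) * ‖g x‖ ^ 2 + (α / 2 + α ^ 2 * L) * ‖r‖ ^ 2 := by
  have h := descent_of_lipschitz_gradient hg hL x (-(α • (g x + r)))
  rw [← sub_eq_add_neg, inner_neg_right, inner_smul_right, inner_add_right,
    real_inner_self_eq_norm_sq, norm_neg, norm_smul, Real.norm_of_nonneg hα.le, mul_pow] at h
  have h1 := norm_add_sq_le_two (g x) r
  have h2 : 0 ≤ ‖g x + r‖ ^ 2 := sq_nonneg _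
  rw [norm_add_sq_real] at h2
  have h3 : L / 2 * (α ^ 2 * ‖g x + r‖ ^ 2)
      ≤ L / 2 * (α ^ 2 * (2 * ‖g x‖ ^ 2 + 2 * ‖r‖ ^ 2)) := by gcongr
  have h4 := mul_nonneg hα.le h2
  linarith

end InnerProduct

/-- Summation of a perturbed descent inequality coupled to a contracting error. -/
lemma sum_le_of_coupled_recursion {K : ℕ} {φ a δ q : ℕ → ℝ} {α L τ ω Φs : ℝ}
    (hα : 0 < α) (hL : 0 ≤ L) (hω : 0 ≤ ω) (hτ : τ < 1)
    (ha : ∀ k, 0 ≤ a k) (hδ : ∀ k, 0 ≤ δ k) (hq : ∀ k, 0 ≤ q k)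
    (hφ : ∀ k < K, φ (k + 1)
      ≤ φ k - (α / 2 - α ^ 2 * L) * a k + (α / 2 + α ^ 2 * L) * (δ k + 3 * q k))
    (hrec : ∀ k < K, δ (k + 1) ≤ τ * δ k + ω * α ^ 2 * (a k + 3 * q k))
    (hstep : α * L + ω * α ^ 2 * (1 / 2 + α * L) * (1 / (1 - τ)) ≤ 1 / 4)
    (hlow : Φs ≤ φ K) :
    ∑ k ∈ Finset.range K, a k
      ≤ 4 * (φ 0 - Φs) / α + 3 * δ 0 / (1 - τ) + 9 * ∑ k ∈ Finset.range K, q k := by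
  set Sa := ∑ k ∈ Finset.range K, a k with hSa
  set Sδ := ∑ k ∈ Finset.range K, δ k with hSδ
  set Sq := ∑ k ∈ Finset.range K, q k with hSq
  have ha0 : 0 ≤ Sa := Finset.sum_nonneg fun k _ => ha k
  have hq0 : 0 ≤ Sq := Finset.sum_nonneg fun k _ => hq k
  have h1 : φ K ≤ φ 0 - (α / 2 - α ^ 2 * L) * Sa + (α / 2 + α ^ 2 * L) * (Sδ + 3 * Sq) := by
    have h : ∑ k ∈ Finset.range K, (φ (k + 1) - φ k)
        ≤ ∑ k ∈ Finset.range K,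
          (-(α / 2 - α ^ 2 * L) * a k + (α / 2 + α ^ 2 * L) * (δ k + 3 * q k)) :=
      Finset.sum_le_sum fun k hk => by linarith [hφ k (Finset.mem_range.1 hk)]
    rw [Finset.sum_range_sub, Finset.sum_add_distrib, ← Finset.mul_sum, ← Finset.mul_sum,
      Finset.sum_add_distrib, ← Finset.mul_sum] at h
    linarith
  have h2 : (1 - τ) * Sδ ≤ δ 0 + ω * α ^ 2 * (Sa + 3 * Sq) := by
    have h : ∑ k ∈ Finset.range K, δ (k + 1)
        ≤ ∑ k ∈ Finset.range K, (τ * δ k + ω * α ^ 2 * (a k + 3 * q k)) :=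
      Finset.sum_le_sum fun k hk => hrec k (Finset.mem_range.1 hk)
    rw [Finset.sum_add_distrib, ← Finset.mul_sum, ← Finset.mul_sum,
      Finset.sum_add_distrib, ← Finset.mul_sum] at h
    -- Shifting the index exchanges `δ 0` for `δ K`; the latter is nonnegative and is dropped.
    have e := (Finset.sum_range_succ' δ K).symm.trans (Finset.sum_range_succ δ K)
    linarith [hδ K]
  have hτ' : 0 < 1 - τ := by linarith
  set v := 1 / (1 - τ) with hv
  have hv0 : 0 < v := by positivity
  have hv1 : v * (1 - τ) = 1 := by rw [hv]; field_simp
  have h3 : Sδ ≤ v * (δ 0 + ω * α ^ 2 * (Sa + 3 * Sq)) := by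
    have := mul_le_mul_of_nonneg_left h2 hv0.le
    rwa [← mul_assoc, hv1, one_mul] at this
  set p := 1 / 2 + α * L with hp
  have hp0 : 0 ≤ p := by positivity
  have hW : 0 ≤ ω * α ^ 2 * p * v := by positivity
  have h4 : α * p * Sδ ≤ α * p * (v * (δ 0 + ω * α ^ 2 * (Sa + 3 * Sq))) := by gcongr
  -- With `W = ω α² p v`, the step condition reads `αL + W ≤ 1/4`. It yields all three constants:
  -- `1/2 - αL - W ≥ 1/4`, `p ≤ 3/4`, and `3 (p + W) ≤ 9/4`.
  have h5 : α * (1 / 4 * Sa) ≤ α * ((φ 0 - Φs) / α + 3 / 4 * (δ 0 * v) + 9 / 4 * Sq) := by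
    have e1 : α * ((φ 0 - Φs) / α) = φ 0 - Φs := by field_simp
    have e2 : α * (1 / 4 * Sa) ≤ α * ((1 / 2 - α * L - ω * α ^ 2 * p * v) * Sa) := by
      gcongr; linarith
    have e3 : α * (p * (δ 0 * v)) ≤ α * (3 / 4 * (δ 0 * v)) := by
      have := hδ 0
      gcongr; linarith
    have e4 : α * (3 * (p + ω * α ^ 2 * p * v) * Sq) ≤ α * (9 / 4 * Sq) := by
      gcongr; linarith
    rw [mul_add, mul_add, e1]
    rw [hp] at h4 e2 e3 e4
    linarith
  have h6 := le_of_mul_le_mul_left h5 hα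
  have e5 : 3 * δ 0 / (1 - τ) = 3 * (δ 0 * v) := by rw [hv]; ring
  have e6 : 4 * (φ 0 - Φs) / α = 4 * ((φ 0 - Φs) / α) := by ring
  rw [e5, e6]
  linarith

/-! ### One outer iteration -/

lemma posDef_of_sub_smul_one {A : Matrix (Fin n) (Fin n) ℝ} {μ : ℝ} (hμ : 0 < μ)
    (h : (A - μ • (1 : Matrix (Fin n) (Fin n) ℝ)).PosSemidef) : A.PosDef := by
  have h1 : (μ • (1 : Matrix (Fin n) (Fin n) ℝ)).PosDef := Matrix.PosDef.one.smul hμ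
  have := Matrix.PosDef.posSemidef_add h h1
  rwa [sub_add_cancel] at this

lemma norm_matVec_inv_le {A : Matrix (Fin n) (Fin n) ℝ} {μ : ℝ} (hμ : 0 < μ)
    (h : (A - μ • (1 : Matrix (Fin n) (Fin n) ℝ)).PosSemidef) (v : E n) :
    ‖matVec A⁻¹ v‖ ≤ 1 / μ * ‖v‖ := by
  have h1 := mul_norm_le_norm_matVec h (matVec A⁻¹ v)
  rw [matVec_mul_inv (posDef_of_sub_smul_one hμ h)] at h1
  rw [one_div_mul_eq_div, le_div_iff₀ hμ]
  linarith

lemma le_of_posSemidef_sub [NeZero n] {A : Matrix (Fin n) (Fin n) ℝ} {μ L : ℝ}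
    (hAμ : (A - μ • (1 : Matrix (Fin n) (Fin n) ℝ)).PosSemidef)
    (hAL : (L • (1 : Matrix (Fin n) (Fin n) ℝ) - A).PosSemidef) : μ ≤ L := by
  set v : E n := EuclideanSpace.single 0 1 with hv
  have h1 := mul_norm_sq_le_inner hAμ v
  have h2 := inner_le_mul_norm_sq hAL v
  have h3 : ‖v‖ = 1 := by simp [hv]
  rw [h3] at h1 h2
  linarith

/-- The mixed derivative is `-I`, of norm `1` in positive dimension. This lets factors `M_{f_xy}` be
inserted to pass from the sharper quadratic constants to the general ones. -/
lemma one_le_Mfxy [NeZero n] {A : Matrix (Fin n) (Fin n) ℝ} {c : Constants} (hA : Aᵀ = A)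
    (hf : LowerAssumption (quadLower A) c) : (1 : ℝ) ≤ c.Mfxy := by
  have h := hf.hessXY_bounded 0 0
  rw [hessXY_quadLower hA, norm_neg] at h
  have h1 := (ContinuousLinearMap.id ℝ (E n)).le_opNorm (EuclideanSpace.single 0 1)
  simp only [ContinuousLinearMap.id_apply, PiLp.norm_single, norm_one, mul_one] at h1
  exact h1.trans h

/-- One outer iteration of qNBO on a quadratic lower-level problem: the lower-level error contracts
and the direction `u` approximates `A⁻¹ ∇_y F`. -/
lemma outerStep_quadratic {A : Matrix (Fin n) (Fin n) ℝ} {F : E n → E n → ℝ} {c : Constants}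
    {p : Params n} (hμ : (0 : ℝ) < c.mu) (hμL : (c.mu : ℝ) ≤ c.L)
    (hAμ : (A - (c.mu : ℝ) • (1 : Matrix (Fin n) (Fin n) ℝ)).PosSemidef)
    (hAL : ((c.L : ℝ) • (1 : Matrix (Fin n) (Fin n) ℝ) - A).PosSemidef)
    (hF : UpperAssumption F c) (hβ : 0 < p.β) (hβ' : p.β ≤ 2 / ((c.mu : ℝ) + c.L))
    (hγ : p.γ = 1) {k : ℕ} (hQ : 1 ≤ p.Q k) (hξ : ∀ i, 0 < p.ξ k i)
    (hH₀ : relFrobDist p.H₀⁻¹ A ≤ 1 / 7) (z : E n × E n) :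
    ‖(outerStep F (quadLower A) p k z).2 - matVec A⁻¹ z.1‖ ^ 2
        ≤ c.rate p.β p.P p.T * ‖z.2 - matVec A⁻¹ z.1‖ ^ 2 ∧
    ∃ u : E n, (outerStep F (quadLower A) p k z).1
        = z.1 - p.α • (gradX F z.1 (outerStep F (quadLower A) p k z).2 + u) ∧
      ‖u - matVec A⁻¹ (gradY F z.1 (outerStep F (quadLower A) p k z).2)‖ ^ 2
        ≤ (c.CFy : ℝ) ^ 2 / (36 * (c.mu : ℝ) ^ 2 * p.Q k) := by
  have hA := posDef_of_sub_smul_one hμ hAμ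
  have hAt := transpose_eq_of_posDef hA
  obtain ⟨R, hR, rfl, hE⟩ := exists_sqrt_relErr_le hA hH₀
  obtain ⟨x, y⟩ := z
  dsimp only
  set A := R * R with hARR
  set grad : E n → E n := fun y => matVec A y - x with hgrad
  have hgradY : gradY (quadLower A) x = grad := gradY_quadLower hAt x
  set σ := subroutineA grad p.H₀ p.β p.γ p.P p.T y with hσ
  set ystar := matVec A⁻¹ x with hystar
  have hx : matVec A ystar = x := matVec_mul_inv hA x
  set d := gradY F x σ.y with hd
  set b := matVec A⁻¹ d with hb
  have hbd : matVec A b = d := matVec_mul_inv hA d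
  set u := if p.Q k = 1 then matVec σ.H d
    else subroutineB grad σ.y p.H₀ d (p.ξ k) (p.Q k) with hu
  have h2 : (outerStep F (quadLower A) p k (x, y)).2 = σ.y := by
    rw [hσ, ← hgradY]; rfl
  have h1 : (outerStep F (quadLower A) p k (x, y)).1 = x - p.α • (gradX F x σ.y + u) := by
    have e : (hessXY (quadLower A) x σ.y).adjoint u = -u := by
      rw [hessXY_quadLower hAt, map_neg, ContinuousLinearMap.adjoint_id]
      rfl
    have e2 : (outerStep F (quadLower A) p k (x, y)).1
        = x - p.α • (gradX F x σ.y - (hessXY (quadLower A) x σ.y).adjoint u) := by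
      rw [hu, hd, hσ, ← hgradY]; rfl
    rw [e2, e, sub_neg_eq_add]
  have hRnorm : ∀ v : E n, ‖matVec R v‖ ^ 2 = inner ℝ v (matVec A v) := fun v => by
    rw [hARR, matVec_mul, ← inner_matVec_of_symm hR, real_inner_self_eq_norm_sq]
  have hRlow : ∀ v : E n, (c.mu : ℝ) * ‖v‖ ^ 2 ≤ ‖matVec R v‖ ^ 2 := fun v => by
    rw [hRnorm]; exact mul_norm_sq_le_inner hAμ v
  have hRup : ∀ v : E n, ‖matVec R v‖ ^ 2 ≤ c.L * ‖v‖ ^ 2 := fun v => by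
    rw [hRnorm]; exact inner_le_mul_norm_sq hAL v
  obtain ⟨hσH, hσy⟩ := bfgs_superlinear hR hx ⟨warmUp grad p.β p.P y, p.H₀⟩ hE p.T
  have hσ' : (qnStep grad 1)^[p.T] ⟨warmUp grad p.β p.P y, p.H₀⟩ = σ := by
    rw [hσ, subroutineA, hγ]
  rw [hσ'] at hσH hσy
  refine ⟨?_, u, ?_, ?_⟩
  · rw [h2]
    have hw := norm_warmUp_sub_le hμ hμL hAμ hAL hβ hβ' hx p.P y
    have hβμ : p.β * (c.mu + c.L) ≤ 2 := by rwa [le_div_iff₀ (by linarith)] at hβ'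
    have hθ0 : 0 ≤ 1 - p.β * c.mu := by nlinarith
    have hθ1 : 1 - p.β * c.mu ≤ 1 := by nlinarith
    set θ := (1 - p.β * (c.mu : ℝ)) ^ p.P with hθ
    have hθ0' : 0 ≤ θ := pow_nonneg hθ0 _
    have hθ1' : θ ≤ 1 := pow_le_one₀ hθ0 hθ1
    -- Squaring the contraction gives `θ²`; only one factor `θ ≤ 1` is kept, as in `rate`.
    have hw2 : ‖warmUp grad p.β p.P y - ystar‖ ^ 2 ≤ θ * ‖y - ystar‖ ^ 2 := by
      calc ‖warmUp grad p.β p.P y - ystar‖ ^ 2 ≤ (θ * ‖y - ystar‖) ^ 2 :=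
            pow_le_pow_left₀ (norm_nonneg _) hw 2
        _ = θ * (θ * ‖y - ystar‖ ^ 2) := by ring
        _ ≤ θ * (1 * ‖y - ystar‖ ^ 2) := by gcongr
        _ = _ := by ring
    -- The factor `κ = L/μ` is the cost of passing to the `A`-norm and back.
    have h3 : (c.mu : ℝ) * ‖σ.y - ystar‖ ^ 2
        ≤ (1 / (p.T : ℝ)) ^ p.T * (c.L * (θ * ‖y - ystar‖ ^ 2)) :=
      calc (c.mu : ℝ) * ‖σ.y - ystar‖ ^ 2 ≤ ‖matVec R (σ.y - ystar)‖ ^ 2 := hRlow _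
        _ ≤ (1 / (p.T : ℝ)) ^ p.T * ‖matVec R (warmUp grad p.β p.P y - ystar)‖ ^ 2 := hσy
        _ ≤ (1 / (p.T : ℝ)) ^ p.T * (c.L * (θ * ‖y - ystar‖ ^ 2)) := by
          gcongr
          exact (hRup _).trans (by gcongr)
    rw [Constants.rate, Constants.kappa, ← hθ]
    rw [← le_div_iff₀' hμ] at h3
    refine h3.trans (le_of_eq ?_)
    ring
  · rw [h1, h2]
  · rw [h2, ← hd, ← hb]
    have hRb : ‖matVec R b‖ ^ 2 ≤ 1 / c.mu * (c.CFy : ℝ) ^ 2 := by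
      have hd2 : ‖d‖ ≤ c.CFy := hF.gradY_bounded x σ.y
      have h3 : ‖b‖ ≤ 1 / c.mu * ‖d‖ := norm_matVec_inv_le hμ hAμ d
      have h4 := real_inner_le_norm b d
      rw [hRnorm, hbd]
      calc inner ℝ b d ≤ ‖b‖ * ‖d‖ := h4
        _ ≤ 1 / c.mu * ‖d‖ * ‖d‖ := by gcongr
        _ = 1 / c.mu * ‖d‖ ^ 2 := by ring
        _ ≤ 1 / c.mu * (c.CFy : ℝ) ^ 2 := by gcongr
    -- Covers both choices of `u`: for `Q = 1`, the bound `‖X‖_F ≤ 1/6` on the final matrix of `𝒜`;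
    -- otherwise the matrix of index `Q - 1` from `ℬ`, whose exponent is `(Q - 1) + 1`.
    have key : ∀ H : Matrix (Fin n) (Fin n) ℝ,
        ‖matVec (relErr R H) (matVec R b)‖ ≤ (1 / 6) ^ p.Q k * ‖matVec R b‖ →
        ‖matVec H d - b‖ ^ 2 ≤ (c.CFy : ℝ) ^ 2 / (36 * (c.mu : ℝ) ^ 2 * p.Q k) := by
      intro H hH
      have h5 := hRlow (matVec H d - b)
      rw [matVec_matVec_sub H hbd] at h5
      have hQ0 : (0 : ℝ) < p.Q k := by exact_mod_cast hQ
      have h6 : (c.mu : ℝ) * ‖matVec H d - b‖ ^ 2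
          ≤ 1 / (36 * (p.Q k : ℝ)) * (1 / c.mu * (c.CFy : ℝ) ^ 2) :=
        calc _ ≤ ‖matVec (relErr R H) (matVec R b)‖ ^ 2 := h5
          _ ≤ ((1 / 6) ^ p.Q k * ‖matVec R b‖) ^ 2 := pow_le_pow_left₀ (norm_nonneg _) hH 2
          _ = ((1 / 6) ^ p.Q k) ^ 2 * ‖matVec R b‖ ^ 2 := mul_pow _ _ _
          _ ≤ _ := mul_le_mul (inv_six_pow_sq_le hQ) hRb (sq_nonneg _) (by positivity)
      rw [← le_div_iff₀' hμ] at h6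
      refine h6.trans (le_of_eq ?_)
      field_simp
    rw [hu]
    split_ifs with hQ1
    · refine key σ.H ?_
      rw [hQ1, pow_one]
      exact (norm_matVec_le _ _).trans (mul_le_mul_of_nonneg_right hσH (norm_nonneg _))
    · refine key _ ?_
      have h7 := (subroutineBMatrix_quadratic (x := x) hR hE σ.y hbd hξ (p.Q k - 1)).2
      rwa [Nat.sub_add_cancel hQ] at h7

/-! ### The gradient of the reduced objective -/

/-- `∇Φ(x) = ∇_x F(x, A⁻¹x) + A⁻¹ ∇_y F(x, A⁻¹x)`. -/
def hyperGrad (F : E n → E n → ℝ) (A : Matrix (Fin n) (Fin n) ℝ) (x : E n) : E n :=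
  gradX F x (matVec A⁻¹ x) + matVec A⁻¹ (gradY F x (matVec A⁻¹ x))

lemma hasGradientAt_upperValue {F : E n → E n → ℝ} {A : Matrix (Fin n) (Fin n) ℝ}
    (hF : Differentiable ℝ (Function.uncurry F)) (hA : A.PosDef) (x : E n) :
    HasGradientAt (upperValue F (quadLower A)) (hyperGrad F A x) x := by
  have e : upperValue F (quadLower A) = fun x => F x (matVec A⁻¹ x) :=
    funext fun x => by rw [upperValue, lowerSol_quadLower hA]
  have ht : A⁻¹ᵀ = A⁻¹ := transpose_eq_of_posDef hA.inv
  rw [e]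
  exact hasGradientAt_comp_graph hF ht x

section

variable {F : E n → E n → ℝ} {A : Matrix (Fin n) (Fin n) ℝ} {c : Constants}

/-- As `A⁻¹` is constant with norm at most `1/μ`, only the Lipschitz constants of `F` enter. `L_Φ`
dominates the result because `M_{f_xy} ≥ 1` and its remaining terms are nonnegative. -/
lemma norm_hyperGrad_sub_le (hF : UpperAssumption F c) (hμ : (0 : ℝ) < c.mu)
    (hM : (1 : ℝ) ≤ c.Mfxy)
    (hAμ : (A - (c.mu : ℝ) • (1 : Matrix (Fin n) (Fin n) ℝ)).PosSemidef) (x x' : E n) :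
    ‖hyperGrad F A x - hyperGrad F A x'‖ ≤ c.LPhi * ‖x - x'‖ := by
  have hS := norm_matVec_inv_le hμ hAμ
  set y := matVec A⁻¹ x with hy
  set y' := matVec A⁻¹ x' with hy'
  have hyy : ‖y - y'‖ ≤ 1 / c.mu * ‖x - x'‖ := by
    rw [hy, hy', ← matVec_map_sub]; exact hS _
  have h1 : ‖gradX F x y - gradX F x y'‖ ≤ c.LFx * (1 / c.mu * ‖x - x'‖) :=
    ((hF.gradX_lipschitz_y x).norm_sub_le y y').trans (by gcongr)
  have h2 : ‖gradX F x y' - gradX F x' y'‖ ≤ c.LFx * ‖x - x'‖ :=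
    (hF.gradX_lipschitz_x y').norm_sub_le x x'
  have h3 : ‖gradY F x y - gradY F x y'‖ ≤ c.LFy * (1 / c.mu * ‖x - x'‖) :=
    ((hF.gradY_lipschitz_y x).norm_sub_le y y').trans (by gcongr)
  have h4 : ‖gradY F x y' - gradY F x' y'‖ ≤ c.LbarFy * ‖x - x'‖ :=
    (hF.gradY_lipschitz_x y').norm_sub_le x x'
  have e : hyperGrad F A x - hyperGrad F A x'
      = (gradX F x y - gradX F x y') + (gradX F x y' - gradX F x' y')
        + (matVec A⁻¹ (gradY F x y - gradY F x y')
          + matVec A⁻¹ (gradY F x y' - gradY F x' y')) := by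
    rw [matVec_map_sub, matVec_map_sub, hyperGrad, hyperGrad]
    abel
  have hL : (c.LFx : ℝ) * (1 / c.mu) + c.LFx
      + (1 / c.mu * (c.LFy * (1 / c.mu)) + 1 / c.mu * c.LbarFy) ≤ c.LPhi := by
    have hC : (c.LFx : ℝ) + c.LFy * (1 / c.mu) ≤ c.C := by
      rw [Constants.C]
      have : (c.LFy : ℝ) * (1 / c.mu) ≤ c.LFy * c.Mfxy / c.mu := by
        rw [mul_one_div]
        gcongr
        exact le_mul_of_one_le_right c.LFy.2 hM
      have : (0 : ℝ) ≤ c.CFy * (c.Lfxy / c.mu + c.Lfyy * c.Mfxy / (c.mu : ℝ) ^ 2) := by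
        positivity
      linarith
    rw [Constants.LPhi]
    have h5 : (0 : ℝ) ≤ c.CFy
        * (c.Lbarfxy * c.CFy / c.mu + c.Lbarfyy * c.Mfxy / (c.mu : ℝ) ^ 2) := by positivity
    have h6 : ((c.LbarFy : ℝ) + (c.LFx + c.LFy * (1 / c.mu))) * 1 / c.mu
        ≤ (c.LbarFy + c.C) * c.Mfxy / c.mu := by
      have := c.C_nonneg
      gcongr
    have e6 : ((c.LbarFy : ℝ) + (c.LFx + c.LFy * (1 / c.mu))) * 1 / c.mu
        = c.LFx * (1 / c.mu) + (1 / c.mu * (c.LFy * (1 / c.mu)) + 1 / c.mu * c.LbarFy) := by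
      ring
    linarith
  rw [e]
  calc _ ≤ ‖gradX F x y - gradX F x y'‖ + ‖gradX F x y' - gradX F x' y'‖
        + (‖matVec A⁻¹ (gradY F x y - gradY F x y')‖
          + ‖matVec A⁻¹ (gradY F x y' - gradY F x' y')‖) :=
        (norm_add_le _ _).trans (add_le_add (norm_add_le _ _) (norm_add_le _ _))
    _ ≤ c.LFx * (1 / c.mu * ‖x - x'‖) + c.LFx * ‖x - x'‖
        + (1 / c.mu * (c.LFy * (1 / c.mu * ‖x - x'‖)) + 1 / c.mu * (c.LbarFy * ‖x - x'‖)) := by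
        gcongr
        · exact (hS _).trans (by gcongr)
        · exact (hS _).trans (by gcongr)
    _ = (c.LFx * (1 / c.mu) + c.LFx
      + (1 / c.mu * (c.LFy * (1 / c.mu)) + 1 / c.mu * c.LbarFy)) * ‖x - x'‖ := by ring
    _ ≤ _ := by gcongr

/-- The error of the approximate hypergradient `∇_x F(x, y) + u`. -/
lemma norm_approx_hyperGrad_sub_sq_le (hF : UpperAssumption F c) (hμ : (0 : ℝ) < c.mu)
    (hM : (1 : ℝ) ≤ c.Mfxy)
    (hAμ : (A - (c.mu : ℝ) • (1 : Matrix (Fin n) (Fin n) ℝ)).PosSemidef) (x y u : E n) :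
    ‖gradX F x y + u - hyperGrad F A x‖ ^ 2
      ≤ 3 * c.D * ‖y - matVec A⁻¹ x‖ ^ 2 + 3 * ‖u - matVec A⁻¹ (gradY F x y)‖ ^ 2 := by
  set y' := matVec A⁻¹ x with hy'
  -- Three errors: `∇_x F` and `∇_y F` at `y` instead of `y*(x)`, and the inexact linear solve.
  have e : gradX F x y + u - hyperGrad F A x = (gradX F x y - gradX F x y')
      + matVec A⁻¹ (gradY F x y - gradY F x y') + (u - matVec A⁻¹ (gradY F x y)) := by
    rw [matVec_map_sub, hyperGrad]
    abel
  have h1 : ‖gradX F x y - gradX F x y'‖ ^ 2 ≤ (c.LFx * ‖y - y'‖) ^ 2 :=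
    pow_le_pow_left₀ (norm_nonneg _) ((hF.gradX_lipschitz_y x).norm_sub_le y y') 2
  have h2 : ‖matVec A⁻¹ (gradY F x y - gradY F x y')‖ ^ 2
      ≤ (1 / c.mu * (c.LFy * ‖y - y'‖)) ^ 2 :=
    pow_le_pow_left₀ (norm_nonneg _) ((norm_matVec_inv_le hμ hAμ _).trans
      (mul_le_mul_of_nonneg_left ((hF.gradY_lipschitz_y x).norm_sub_le y y')
        (by positivity))) 2
  have hD : (c.LFx : ℝ) ^ 2 + (1 / c.mu * c.LFy) ^ 2 ≤ c.D := by
    have h3 : (1 : ℝ) * (c.LFy : ℝ) ^ 2 / (c.mu : ℝ) ^ 2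
        ≤ 2 * (c.Mfxy : ℝ) ^ 2 * (c.LFy : ℝ) ^ 2 / (c.mu : ℝ) ^ 2 := by
      gcongr
      nlinarith
    have h4 : (0 : ℝ) ≤ (c.Lfxy : ℝ) ^ 2 * (c.CFy : ℝ) ^ 2 / (c.mu : ℝ) ^ 2 := by positivity
    have e3 : (1 : ℝ) * (c.LFy : ℝ) ^ 2 / (c.mu : ℝ) ^ 2 = (1 / c.mu * c.LFy) ^ 2 := by ring
    rw [Constants.D]
    linarith
  have h5 := mul_le_mul_of_nonneg_right hD (sq_nonneg ‖y - y'‖)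
  rw [e]
  have := norm_add_add_sq_le (gradX F x y - gradX F x y')
    (matVec A⁻¹ (gradY F x y - gradY F x y')) (u - matVec A⁻¹ (gradY F x y))
  linarith

end

/-! ### Coupling of the lower-level error with the outer descent -/

lemma Constants.rate_nonneg (c : Constants) {β : ℝ} (hμ : (0 : ℝ) < c.mu)
    (hμL : (c.mu : ℝ) ≤ c.L) (hβ' : β ≤ 2 / ((c.mu : ℝ) + c.L)) (P T : ℕ) :
    0 ≤ c.rate β P T := by
  have hβμ : β * (c.mu + c.L) ≤ 2 := by rwa [le_div_iff₀ (by linarith)] at hβ'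
  have h : 0 ≤ 1 - β * c.mu := by nlinarith
  rw [Constants.rate, Constants.kappa]
  exact mul_nonneg (by positivity) (pow_nonneg h _)

/-- The lower-level error after an outer step of length `α`. -/
lemma norm_sub_matVec_inv_sq_le {A : Matrix (Fin n) (Fin n) ℝ} {c : Constants}
    (hμ : (0 : ℝ) < c.mu) (hM : (1 : ℝ) ≤ c.Mfxy)
    (hAμ : (A - (c.mu : ℝ) • (1 : Matrix (Fin n) (Fin n) ℝ)).PosSemidef) {α ε : ℝ} (hα : 0 < α)
    (hε : 0 < ε) (x y g r : E n) :
    ‖y - matVec A⁻¹ (x - α • (g + r))‖ ^ 2 ≤ (1 + ε) * ‖y - matVec A⁻¹ x‖ ^ 2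
      + (1 + 1 / ε) * (c.Ly ^ 2 * α ^ 2 * (2 * ‖g‖ ^ 2 + 2 * ‖r‖ ^ 2)) := by
  have e : y - matVec A⁻¹ (x - α • (g + r))
      = (y - matVec A⁻¹ x) + matVec A⁻¹ (α • (g + r)) := by
    rw [matVec_map_sub]; abel
  have h1 : ‖matVec A⁻¹ (α • (g + r))‖ ≤ c.Ly * α * ‖g + r‖ := by
    refine (norm_matVec_inv_le hμ hAμ _).trans ?_
    rw [norm_smul, Real.norm_of_nonneg hα.le, Constants.Ly, mul_assoc]
    gcongr
  have h2 : ‖matVec A⁻¹ (α • (g + r))‖ ^ 2 ≤ c.Ly ^ 2 * α ^ 2 * (2 * ‖g‖ ^ 2 + 2 * ‖r‖ ^ 2) :=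
    calc _ ≤ (c.Ly * α * ‖g + r‖) ^ 2 := pow_le_pow_left₀ (norm_nonneg _) h1 2
      _ = c.Ly ^ 2 * α ^ 2 * ‖g + r‖ ^ 2 := by ring
      _ ≤ _ := by gcongr; exact norm_add_sq_le_two g r
  rw [e]
  refine (norm_add_sq_le_young hε _ _).trans ?_
  gcongr

/-- The convergence bound of qNBO on a quadratic lower-level problem, with the sharper error term
`9 C_{F_y}² / (36 μ² Q_k)`. -/
theorem sum_norm_hyperGrad_sq_le [NeZero n] {A : Matrix (Fin n) (Fin n) ℝ}
    {F : E n → E n → ℝ} {c : Constants} {p : Params n} {x₀ y₀ : E n} {K : ℕ} {ε : ℝ}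
    (hAμ : (A - (c.mu : ℝ) • (1 : Matrix (Fin n) (Fin n) ℝ)).PosSemidef)
    (hAL : ((c.L : ℝ) • (1 : Matrix (Fin n) (Fin n) ℝ) - A).PosSemidef)
    (hf : LowerAssumption (quadLower A) c) (hF : UpperAssumption F c)
    (hΦ : BddBelow (Set.range (upperValue F (quadLower A))))
    (hα : 0 < p.α) (hε : 0 < ε) (hβ : 0 < p.β) (hβ' : p.β ≤ 2 / ((c.mu : ℝ) + c.L))
    (hγ : p.γ = 1) (hQ : ∀ k < K, 1 ≤ p.Q k) (hξ : ∀ k i, 0 < p.ξ k i)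
    (hH₀ : relFrobDist p.H₀⁻¹ A ≤ 1 / 7)
    (hτ : c.tau p.α p.β ε p.P p.T < 1)
    (hstep : p.α * c.LPhi
        + c.omega p.β ε p.P p.T * p.α ^ 2 * (1 / 2 + p.α * c.LPhi)
            * (1 / (1 - c.tau p.α p.β ε p.P p.T)) ≤ 1 / 4) :
    ∑ k ∈ Finset.range K, ‖hyperGrad F A (iterates F (quadLower A) p x₀ y₀ k).1‖ ^ 2
      ≤ 4 * (upperValue F (quadLower A) x₀ - ⨅ x, upperValue F (quadLower A) x) / p.α
        + 3 * (3 * c.rate p.β p.P p.T * c.D * ‖y₀ - matVec A⁻¹ x₀‖ ^ 2)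
            / (1 - c.tau p.α p.β ε p.P p.T)
        + 9 * ∑ k ∈ Finset.range K, (c.CFy : ℝ) ^ 2 / (36 * (c.mu : ℝ) ^ 2 * p.Q k) := by
  have hμ : (0 : ℝ) < c.mu := hf.mu_pos
  have hμL : (c.mu : ℝ) ≤ c.L := le_of_posSemidef_sub hAμ hAL
  have hA : A.PosDef := posDef_of_sub_smul_one hμ hAμ
  have hM : (1 : ℝ) ≤ c.Mfxy := one_le_Mfxy (transpose_eq_of_posDef hA) hf
  have hρ := c.rate_nonneg hμ hμL hβ' p.P p.T
  have hD := c.D_nonneg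
  have hL := c.LPhi_nonneg
  set ρ := c.rate p.β p.P p.T with hρdef
  set Z := iterates F (quadLower A) p x₀ y₀ with hZ
  set q : ℕ → ℝ := fun k => (c.CFy : ℝ) ^ 2 / (36 * (c.mu : ℝ) ^ 2 * p.Q k) with hq
  set a : ℕ → ℝ := fun k => ‖hyperGrad F A (Z k).1‖ ^ 2 with ha
  -- The factor `3 ρ D` makes `δ k` bound the hypergradient error due to `y_{k+1}`, after the inner
  -- loop has contracted the error of `y_k` by `ρ`.
  set δ : ℕ → ℝ := fun k => 3 * ρ * c.D * ‖(Z k).2 - matVec A⁻¹ (Z k).1‖ ^ 2 with hδ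
  have hstepk : ∀ k < K, ∃ r : E n,
      (Z (k + 1)).1 = (Z k).1 - p.α • (hyperGrad F A (Z k).1 + r) ∧
      ‖(Z (k + 1)).2 - matVec A⁻¹ (Z k).1‖ ^ 2
        ≤ ρ * ‖(Z k).2 - matVec A⁻¹ (Z k).1‖ ^ 2 ∧
      ‖r‖ ^ 2 ≤ δ k + 3 * q k := by
    intro k hk
    obtain ⟨h1, u, h2, h3⟩ := outerStep_quadratic hμ hμL hAμ hAL hF hβ hβ' hγ (hQ k hk) (hξ k)
      hH₀ (Z k)
    have hsucc : Z (k + 1) = outerStep F (quadLower A) p k (Z k) := rfl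
    rw [← hsucc] at h1 h2 h3
    refine ⟨gradX F (Z k).1 (Z (k + 1)).2 + u - hyperGrad F A (Z k).1, ?_, h1, ?_⟩
    · rw [h2, add_sub_cancel]
    · have h4 := norm_approx_hyperGrad_sub_sq_le hF hμ hM hAμ (Z k).1 (Z (k + 1)).2 u
      have h5 : 3 * c.D * ‖(Z (k + 1)).2 - matVec A⁻¹ (Z k).1‖ ^ 2
          ≤ 3 * c.D * (ρ * ‖(Z k).2 - matVec A⁻¹ (Z k).1‖ ^ 2) := by gcongr
      simp only [hδ, hq]
      linarith
  refine sum_le_of_coupled_recursion (φ := fun k => upperValue F (quadLower A) (Z k).1) (a := a)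
    (δ := δ) (q := q) hα hL (ω := c.omega p.β ε p.P p.T) ?_ hτ (fun k => sq_nonneg _)
    (fun k => by positivity) (fun k => by positivity) ?_ ?_ hstep (ciInf_le hΦ _)
  · rw [Constants.omega, ← hρdef]; positivity
  · intro k hk
    obtain ⟨r, h1, -, h3⟩ := hstepk k hk
    have h4 := inexact_gradient_step (hasGradientAt_upperValue hF.differentiable hA)
      (norm_hyperGrad_sub_le hF hμ hM hAμ) hL hα (Z k).1 r
    rw [← h1] at h4
    refine h4.trans ?_
    gcongr
  · intro k hk
    obtain ⟨r, h1, h2, h3⟩ := hstepk k hk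
    have h4 := norm_sub_matVec_inv_sq_le hμ hM hAμ hα hε (Z k).1 (Z (k + 1)).2
      (hyperGrad F A (Z k).1) r
    rw [← h1] at h4
    -- The part of `‖r‖²` coming from `δ k` feeds back into the recursion; this is the second
    -- summand of `τ`, while the coefficient of `a k + 3 q k` is `ω α²`.
    have h5 : δ (k + 1) ≤ 3 * ρ * c.D * ((1 + ε) * (ρ * ‖(Z k).2 - matVec A⁻¹ (Z k).1‖ ^ 2)
        + (1 + 1 / ε) * (c.Ly ^ 2 * p.α ^ 2 * (2 * a k + 2 * (δ k + 3 * q k)))) := by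
      simp only [hδ] at h3 ⊢
      refine mul_le_mul_of_nonneg_left (h4.trans ?_) (by positivity)
      gcongr
    refine h5.trans (le_of_eq ?_)
    rw [Constants.tau, Constants.omega, ← hρdef]
    simp only [hδ]
    ring

end QNBO
end

theorem mainTheorem4
    {n : ℕ} (A : Matrix (Fin n) (Fin n) ℝ) (F : QNBO.E n → QNBO.E n → ℝ)
    (c : QNBO.Constants) (p : QNBO.Params n) (x₀ y₀ : QNBO.E n) (K : ℕ) (ε : ℝ)
    -- `μ I ⪯ A ⪯ L I`
    (hAμ : (A - (c.mu : ℝ) • (1 : Matrix (Fin n) (Fin n) ℝ)).PosSemidef)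
    (hAL : ((c.L : ℝ) • (1 : Matrix (Fin n) (Fin n) ℝ) - A).PosSemidef)
    (hf : QNBO.LowerAssumption (QNBO.quadLower A) c)
    (hF : QNBO.UpperAssumption F c)
    (hΦ : BddBelow (Set.range (QNBO.upperValue F (QNBO.quadLower A))))
    -- admissible parameters of the algorithm
    (hK : 0 < K) (hT : 0 < p.T) (hα : 0 < p.α) (hε : 0 < ε)
    (hβ : 0 < p.β) (hβ' : p.β ≤ 2 / ((c.mu : ℝ) + c.L)) (hγ : p.γ = 1)
    (hQ : ∀ k < K, 1 ≤ p.Q k) (hξ : ∀ k i, 0 < p.ξ k i)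
    -- the warm-up steps bring `y_k` close to `y*(x_k)`
    (hwarm : ∀ k < K,
      (1 - p.β * c.mu) ^ p.P *
          ‖(QNBO.iterates F (QNBO.quadLower A) p x₀ y₀ k).2
            - QNBO.lowerSol (QNBO.quadLower A)
                (QNBO.iterates F (QNBO.quadLower A) p x₀ y₀ k).1‖
        ≤ 1 / (300 * Real.sqrt c.mu))
    -- relative Frobenius closeness of `H₀⁻¹` to `∇²_yy f(x_k, y*(x_k))`
    (hH₀ : ∀ k < K,
      QNBO.relFrobDist p.H₀⁻¹
          (QNBO.hessYYMatrix (QNBO.quadLower A)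
            (QNBO.iterates F (QNBO.quadLower A) p x₀ y₀ k).1
            (QNBO.lowerSol (QNBO.quadLower A)
              (QNBO.iterates F (QNBO.quadLower A) p x₀ y₀ k).1))
        ≤ 1 / 7)
    (hτ : c.tau p.α p.β ε p.P p.T < 1)
    (hstep : p.α * c.LPhi
        + c.omega p.β ε p.P p.T * p.α ^ 2 * (1 / 2 + p.α * c.LPhi)
            * (1 / (1 - c.tau p.α p.β ε p.P p.T)) ≤ 1 / 4) :
    Differentiable ℝ (QNBO.upperValue F (QNBO.quadLower A)) ∧
    1 / (K : ℝ) * ∑ k ∈ Finset.range K,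
        ‖gradient (QNBO.upperValue F (QNBO.quadLower A))
          (QNBO.iterates F (QNBO.quadLower A) p x₀ y₀ k).1‖ ^ 2
      ≤ 4 * (QNBO.upperValue F (QNBO.quadLower A) x₀
            - ⨅ x, QNBO.upperValue F (QNBO.quadLower A) x) / (p.α * K)
        + 3 * (3 * c.rate p.β p.P p.T * c.D
              * ‖QNBO.lowerSol (QNBO.quadLower A) x₀ - y₀‖ ^ 2)
            / (K * (1 - c.tau p.α p.β ε p.P p.T))
        + 1 / (K : ℝ) * ∑ k ∈ Finset.range K,
            18 * (n : ℝ) * c.L * (c.Mfxy : ℝ) ^ 2 * (c.CFy : ℝ) ^ 2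
              / ((c.mu : ℝ) ^ 3 * p.Q k) := by
  have hμ : (0 : ℝ) < c.mu := hf.mu_pos
  have hA : A.PosDef := QNBO.posDef_of_sub_smul_one hμ hAμ
  have hgrad := QNBO.hasGradientAt_upperValue hF.differentiable hA
  refine ⟨fun x => (hgrad x).differentiableAt, ?_⟩
  -- In dimension `0` all norms vanish and `Φ` is constant; `μ ≤ L` and `M_{f_xy} ≥ 1` are available
  -- only for `n ≥ 1`.
  rcases Nat.eq_zero_or_pos n with rfl | hn
  · have hinf : ⨅ x, QNBO.upperValue F (QNBO.quadLower A) x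
        = QNBO.upperValue F (QNBO.quadLower A) x₀ := ciInf_subsingleton x₀ _
    have hz : ∀ v : QNBO.E 0, ‖v‖ = 0 := fun v => by rw [Subsingleton.elim v 0, norm_zero]
    simp only [hz, hinf]
    simp
  · have : NeZero n := ⟨hn.ne'⟩
    have hμL : (c.mu : ℝ) ≤ c.L := QNBO.le_of_posSemidef_sub hAμ hAL
    have hM : (1 : ℝ) ≤ c.Mfxy := QNBO.one_le_Mfxy (QNBO.transpose_eq_of_posDef hA) hf
    -- The Hessian is `A` at every point, so a single instance gives the closeness of `H₀`.
    have hH₀' := hH₀ 0 hK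
    rw [QNBO.hessYYMatrix_quadLower (QNBO.transpose_eq_of_posDef hA)] at hH₀'
    have h := QNBO.sum_norm_hyperGrad_sq_le (x₀ := x₀) (y₀ := y₀) hAμ hAL hf hF hΦ hα hε hβ hβ' hγ
      hQ hξ hH₀' hτ hstep
    have hK' : (0 : ℝ) < K := by exact_mod_cast hK
    -- Here `9/36 = 1/4`, enlarged to `18 n (L/μ) M_{f_xy}²` using `n ≥ 1`, `L ≥ μ` and `M_{f_xy} ≥
    -- 1`.
    have hq : 9 * ∑ k ∈ Finset.range K, (c.CFy : ℝ) ^ 2 / (36 * (c.mu : ℝ) ^ 2 * p.Q k)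
        ≤ ∑ k ∈ Finset.range K, 18 * (n : ℝ) * c.L * (c.Mfxy : ℝ) ^ 2 * (c.CFy : ℝ) ^ 2
              / ((c.mu : ℝ) ^ 3 * p.Q k) := by
      rw [Finset.mul_sum]
      refine Finset.sum_le_sum fun k hk => ?_
      have hQ0 : (0 : ℝ) < p.Q k := by exact_mod_cast hQ k (Finset.mem_range.1 hk)
      have hn1 : (1 : ℝ) ≤ n := by exact_mod_cast hn
      calc 9 * ((c.CFy : ℝ) ^ 2 / (36 * (c.mu : ℝ) ^ 2 * p.Q k))
          = 1 / 4 * 1 * c.mu * 1 ^ 2 * (c.CFy : ℝ) ^ 2 / ((c.mu : ℝ) ^ 3 * p.Q k) := by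
            field_simp
            ring
        _ ≤ _ := by
            gcongr
            norm_num
    have h1 : ∀ x, gradient (QNBO.upperValue F (QNBO.quadLower A)) x = QNBO.hyperGrad F A x :=
      fun x => (hgrad x).gradient
    simp only [h1]
    rw [QNBO.lowerSol_quadLower hA, norm_sub_rev (QNBO.matVec A⁻¹ x₀) y₀]
    refine (mul_le_mul_of_nonneg_left (h.trans (add_le_add_right hq _)) (by positivity)).trans
      (le_of_eq ?_)
    generalize 1 - c.tau p.α p.β ε p.P p.T = t
    ring
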